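/- For $x>0$, $\rho>0$ and real $\alpha$ let \[F(x,\rho,\alpha)=\int_{-\infty}^{\infty}\exp\bigl[-\tfrac12\rho\cosh(2u-i\alpha)\bigr]\cos(x\cosh u)\,du,\qquad M=\frac{x^2}{4\rho}.\] Let $(a)_r=a(a+1)\cdots(a+r-1)$ and let \[\mathbf H_\nu(x)=\sum_{k\ge0}\frac{(-1)^k(x/2)^{2k+\nu+1}}{\Gamma(k+\frac32)\Gamma(k+\nu+\frac32)},\qquad \mathcal H_\nu(x)=(x/2)^{-\nu}\,\mathbf H_\nu(x)\] be the Struve function and the scaled Struve function. Let $Y_m$ be the Bessel function of the second kind, $\mathbf K_m=\mathbf H_m-Y_m$ and $\mathcal K_m(x)=x^m\mathbf K_m(x)$. For integers $k\ge0$ let \[C_k(x)=\frac2\pi\,x^{2k}\int_0^\infty\frac{\xi^{2k}e^{-x\xi}}{\sqrt{1+\xi^2}}\,d\xi .\] (i) For every $x>0$ the integrals $C_m(x)$ $(m\ge0)$ converge and satisfy the recurrence \[C_m(x)=2^m(\tfrac12)_m\,\mathcal K_m(x)-\sum_{r=0}^{m-1}\binom mr x^{2(m-r)}C_r(x)\qquad(m\ge0);\]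 in particular $C_0(x)=\mathcal K_0(x)$. (ii) Let $X,R>0$ (for instance $X=R=1$). There are constants $A,B$, depending only on $X$ and $R$, and constants $K_n$ $(n\ge1)$, depending only on $n$, $X$ and $R$, such that for all $0<x<X$ and $0<\rho<R$ the integral $F(x,\rho,0)$ converges absolutely, the series $\sum_r\frac{(1/2)_r}{r!}\rho^r\mathcal H_r(x)$ converges absolutely, and for every positive integer $n<M$ \[F(x,\rho,0)=-\pi e^{-\rho/2}\sum_{r=0}^\infty\frac{(\frac12)_r}{r!}\,\rho^r\mathcal H_r(x)+\pi e^{\rho/2}\Bigl\{\sum_{k=0}^{n-1}\frac{M^{-k}}{2^{2k}k!}\,C_k(x)+E_1\Bigr\}+E_2+E_3\] with $|E_1|\le K_nM^{-n}$, $|E_2|\le A\,e^{-M}$ and $|E_3|\le B\,M^{-1}e^{-M}$. That is, for fixed $n$ the errors are $O(M^{-n})$ inside the braces and $O(e^{-M})+O(M^{-1}e^{-M})$ outside, as $M\to\infty$, uniformly in $x$ and $\rho$. -/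

import Mathlib

noncomputable section

namespace KelvinWave

open MeasureTheory

/-- The integrand of the Kelvin ship-wave integral. -/
def integrand (x ρ α u : ℝ) : ℂ :=
  Complex.exp (-((ρ : ℂ) / 2) * Complex.cosh (2 * (u : ℂ) - Complex.I * (α : ℂ))) *
    Complex.cos ((x : ℂ) * Complex.cosh (u : ℂ))

/-- `F(x, ρ, α) = ∫_{-∞}^{∞} exp[-(ρ/2) cosh(2u - iα)] cos(x cosh u) du`. -/
def F (x ρ α : ℝ) : ℂ := ∫ u : ℝ, integrand x ρ α u

/-- The large parameter `M = x² / (4ρ)`. -/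
def bigM (x ρ : ℝ) : ℝ := x ^ 2 / (4 * ρ)

/-- Pochhammer's symbol `(a)_r = a (a + 1) ⋯ (a + r - 1)`. -/
def poch (a : ℝ) (r : ℕ) : ℝ := (ascPochhammer ℝ r).eval a

/-- The Struve function `𝐇_ν(x)`, for `x > 0`. -/
def struveH (ν x : ℝ) : ℝ :=
  ∑' k : ℕ, (-1) ^ k * (x / 2) ^ (2 * (k : ℝ) + ν + 1) /
    (Real.Gamma (k + 3 / 2) * Real.Gamma (k + ν + 3 / 2))

/-- The scaled Struve function `(x/2)^{-ν} 𝐇_ν(x)`. -/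
def scaledStruve (ν x : ℝ) : ℝ := (x / 2) ^ (-ν) * struveH ν x

/-- The Bessel function of the first kind `J_n(x)`, of integer order `n ≥ 0`. -/
def besselJ (n : ℕ) (x : ℝ) : ℝ :=
  ∑' k : ℕ, (-1) ^ k * (x / 2) ^ (2 * k + n) / ((k.factorial : ℝ) * ((n + k).factorial : ℝ))

/-- The digamma function at a positive integer, `ψ(j + 1) = 1 + 1/2 + ⋯ + 1/j - γ`. -/
def digammaSucc (j : ℕ) : ℝ := (harmonic j : ℝ) - Real.eulerMascheroniConstant

/-- The Bessel function of the second kind `Y_n(x)`, of integer order `n ≥ 0`, for `x > 0`,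
by its standard series
`π Y_n(x) = 2 log(x/2) J_n(x) - (x/2)^{-n} ∑_{k<n} (n-k-1)!/k! (x²/4)^k
  - (x/2)^n ∑_k (ψ(k+1) + ψ(n+k+1)) (-x²/4)^k / (k! (n+k)!)`. -/
def besselY (n : ℕ) (x : ℝ) : ℝ :=
  (2 * Real.log (x / 2) * besselJ n x
    - ((x / 2) ^ n)⁻¹ *
        ∑ k ∈ Finset.range n,
          ((n - k - 1).factorial : ℝ) / (k.factorial : ℝ) * (x ^ 2 / 4) ^ k
    - (x / 2) ^ n *
        ∑' k : ℕ, (digammaSucc k + digammaSucc (n + k)) * (-(x ^ 2 / 4)) ^ k /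
          ((k.factorial : ℝ) * ((n + k).factorial : ℝ))) / Real.pi

/-- The Struve function `𝐊_m(x) = 𝐇_m(x) - Y_m(x)`, of integer order `m ≥ 0`. -/
def struveK (m : ℕ) (x : ℝ) : ℝ := struveH m x - besselY m x

/-- `𝓚_m(x) = x^m 𝐊_m(x)`. -/
def scaledK (m : ℕ) (x : ℝ) : ℝ := x ^ m * struveK m x

/-- The integrand of the Laplace-type integral in `C_k(x)`. -/
def coeffIntegrand (k : ℕ) (x ξ : ℝ) : ℝ :=
  ξ ^ (2 * k) * Real.exp (-x * ξ) / √(1 + ξ ^ 2)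

/-- `C_k(x) = (2/π) x^{2k} ∫_0^∞ ξ^{2k} e^{-xξ} / √(1 + ξ²) dξ`. -/
def coeffC (k : ℕ) (x : ℝ) : ℝ :=
  2 / Real.pi * x ^ (2 * k) * ∫ ξ in Set.Ioi (0 : ℝ), coeffIntegrand k x ξ

/-- The terms of the convergent Struve series, `((1/2)_r / r!) ρ^r 𝓗_r(x)`. -/
def struveTerm (x ρ : ℝ) (r : ℕ) : ℝ :=
  poch (1 / 2) r / (r.factorial : ℝ) * ρ ^ r * scaledStruve r x

/-- The truncated asymptotic series `∑_{k<n} M^{-k} C_k(x) / (2^{2k} k!)`. -/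
def asympSum (x ρ : ℝ) (n : ℕ) : ℝ :=
  ∑ k ∈ Finset.range n,
    (bigM x ρ ^ k)⁻¹ / (2 ^ (2 * k) * (k.factorial : ℝ)) * coeffC k x

end KelvinWave

end

/-
Part (i). Let `G_p(x) = ∫_0^∞ (x² + s²)^p e^{-s} ds`. Substituting `s = x ξ` and expanding
`(1 + ξ²)^m` by the binomial theorem gives
`(2/π) G_{m-1/2}(x) = ∑_{r ≤ m} (m choose r) x^{2(m-r)} C_r(x)`, so the recurrence says that
`(2/π) G_{m-1/2} = 2^m (1/2)_m 𝓚_m`. Both sides have the same limit at `0` and, up to the same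
constant, obey `𝓚_{m+1}' = x 𝓚_m`, so the identity for `m` implies that for `m + 1`. For `m = 0`,
the differences `f`, `g` between the two sides for `m = 0` and `m = 1` solve `f' = -g/x`, `g' = x f`
and vanish at `0`; the energy `f² + (g/x)²` is nonincreasing and tends to `0` at `0`, hence `f = 0`.

Part (ii). `F(x, ρ, 0) = 2 e^{ρ/2} Re ∫_0^∞ exp(-ρ cosh² u + i x cosh u) du`. Cut the half-line at
`a = arsinh(x / 2ρ)`, where `a + iπ/2` is a saddle point, and apply Cauchy's theorem to the
rectangle `[0, a] × [0, π/2]`. The left side gives the Poisson integrals of the Struve series. On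
the upper side `ξ = sinh t` turns the integral into `∫_0^{x/2ρ} e^{ρξ² - xξ} dξ / √(1 + ξ²)`, and
the Taylor expansion of `e^{ρξ²}` produces the terms `C_k`. The right side, where the integrand is
at most `e^{-M}` in absolute value, contributes `E₂`, and the half-line beyond `a` contributes `E₃`.
-/

noncomputable section

namespace KelvinWave

open MeasureTheory Filter Topology Set

/-! ### Everywhere convergent series in `x / 2` -/

/-- The sequence `c` is the coefficient sequence of an everywhere convergent power series; it is
what allows `halfPowSeries c p` to be differentiated termwise. -/
def IsEntireCoeff (c : ℕ → ℝ) : Prop := ∀ r : ℝ, Summable fun k => c k * r ^ k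

/-- The series `∑ c_k (x/2)^{2k+p}`, the common shape of the expansions of Bessel and Struve
functions. -/
def halfPowSeries (c : ℕ → ℝ) (p : ℕ) (x : ℝ) : ℝ := ∑' k : ℕ, c k * (x / 2) ^ (2 * k + p)

namespace IsEntireCoeff

variable {c d : ℕ → ℝ}

lemma of_abs_le {C : ℝ} (hc : ∀ k, |c k| ≤ C / k.factorial) : IsEntireCoeff c := fun r => by
  refine Summable.of_norm_bounded ((Real.summable_pow_div_factorial |r|).mul_left C) fun k => ?_
  rw [Real.norm_eq_abs, abs_mul, abs_pow, ← mul_comm_div]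
  gcongr
  exact hc k

lemma mul_add (hc : IsEntireCoeff c) {q : ℝ} (hq : 0 ≤ q) :
    IsEntireCoeff fun k => c k * (k + q) := fun r => by
  refine Summable.of_norm_bounded ((hc (2 * r)).abs.mul_left (1 + q)) fun k => ?_
  have hk : (k : ℝ) + q ≤ (1 + q) * 2 ^ k := by
    have h₁ : (k : ℝ) ≤ 2 ^ k := by exact_mod_cast Nat.lt_two_pow_self.le
    have h₂ : (1 : ℝ) ≤ 2 ^ k := one_le_pow₀ one_le_two
    nlinarith
  calc ‖c k * (k + q) * r ^ k‖ = |c k| * (k + q) * |r| ^ k := by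
        rw [Real.norm_eq_abs, abs_mul, abs_mul, abs_pow, abs_of_nonneg (by positivity : 0 ≤ k + q)]
    _ ≤ |c k| * ((1 + q) * 2 ^ k) * |r| ^ k := by gcongr
    _ = (1 + q) * |c k * (2 * r) ^ k| := by
        rw [abs_mul, abs_pow, abs_mul, abs_two, mul_pow]; ring

lemma comp_succ (hc : IsEntireCoeff c) : IsEntireCoeff fun k => c (k + 1) := fun r => by
  refine Summable.of_norm_bounded ((summable_nat_add_iff 1).2 (hc (max 1 |r|)).abs) fun k => ?_
  rw [Real.norm_eq_abs, abs_mul, abs_mul, abs_pow, abs_pow,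
    abs_of_pos (by positivity : 0 < max 1 |r|)]
  gcongr
  calc |r| ^ k ≤ max 1 |r| ^ k := by gcongr; exact le_max_right _ _
    _ ≤ max 1 |r| ^ (k + 1) := pow_le_pow_right₀ (le_max_left _ _) k.le_succ

lemma summable_half_pow (hc : IsEntireCoeff c) (p : ℕ) (x : ℝ) :
    Summable fun k => c k * (x / 2) ^ (2 * k + p) := by
  refine ((hc ((x / 2) ^ 2)).mul_right ((x / 2) ^ p)).congr fun k => ?_
  rw [pow_add, pow_mul, mul_assoc]

lemma halfPowSeries_add (hc : IsEntireCoeff c) (hd : IsEntireCoeff d) (p : ℕ) (x : ℝ) :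
    halfPowSeries (fun k => c k + d k) p x = halfPowSeries c p x + halfPowSeries d p x := by
  rw [halfPowSeries, halfPowSeries, halfPowSeries,
    ← (hc.summable_half_pow p x).tsum_add (hd.summable_half_pow p x)]
  simp only [add_mul]

lemma halfPowSeries_eq_add (hc : IsEntireCoeff c) (p : ℕ) (x : ℝ) :
    halfPowSeries c p x =
      c 0 * (x / 2) ^ p + halfPowSeries (fun k => c (k + 1)) (p + 2) x := by
  rw [halfPowSeries, (hc.summable_half_pow p x).tsum_eq_zero_add, mul_zero, zero_add,
    halfPowSeries]
  congr 1
  exact tsum_congr fun k => by ring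

lemma hasDerivAt_halfPowSeries_succ (hc : IsEntireCoeff c) (p : ℕ) (x : ℝ) :
    HasDerivAt (halfPowSeries c (p + 1))
      (halfPowSeries (fun k => c k * (k + ((p + 1 : ℕ) : ℝ) / 2)) p x) x := by
  set r := |x| + 1
  refine hasDerivAt_tsum_of_isPreconnected (t := Metric.ball (0 : ℝ) r) (y₀ := (0 : ℝ))
    (g := fun k y => c k * (y / 2) ^ (2 * k + (p + 1)))
    (g' := fun k y => c k * (k + ((p + 1 : ℕ) : ℝ) / 2) * (y / 2) ^ (2 * k + p))
    ((hc.mul_add (q := ((p + 1 : ℕ) : ℝ) / 2) (by positivity)).summable_half_pow p r).abs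
    Metric.isOpen_ball (convex_ball (0 : ℝ) r).isPreconnected (fun k y _ => ?_)
    (fun k y hy => ?_) (Metric.mem_ball_self (by positivity)) ?_ (by simp [r])
  · refine ((((hasDerivAt_id' y).div_const 2).pow (2 * k + (p + 1))).const_mul (c k)).congr_deriv ?_
    push_cast
    rw [show 2 * k + (p + 1) - 1 = 2 * k + p by lia]
    ring
  · have hyr : |y| ≤ |r| := (mem_ball_zero_iff.1 hy).le.trans (le_abs_self r)
    rw [Real.norm_eq_abs, abs_mul, abs_mul (_ * _), abs_pow, abs_pow, abs_div, abs_div]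
    gcongr
  · simp [← add_assoc]

lemma hasDerivAt_halfPowSeries_zero (hc : IsEntireCoeff c) (x : ℝ) :
    HasDerivAt (halfPowSeries c 0) (halfPowSeries (fun k => (k + 1) * c (k + 1)) 1 x) x := by
  have h := (hc.comp_succ.hasDerivAt_halfPowSeries_succ 1 x).const_add (c 0)
  refine (h.congr_of_eventuallyEq (.of_forall fun y => ?_)).congr_deriv ?_
  · rw [hc.halfPowSeries_eq_add, pow_zero, mul_one]
  · exact tsum_congr fun k => by push_cast; ring

lemma continuous_halfPowSeries (hc : IsEntireCoeff c) (p : ℕ) :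
    Continuous (halfPowSeries c p) :=
  continuous_iff_continuousAt.2 fun x => by
    cases p with
    | zero => exact (hc.hasDerivAt_halfPowSeries_zero x).continuousAt
    | succ p => exact (hc.hasDerivAt_halfPowSeries_succ p x).continuousAt

end IsEntireCoeff

lemma halfPowSeries_add_order (c : ℕ → ℝ) (p n : ℕ) (x : ℝ) :
    halfPowSeries c (p + n) x = (x / 2) ^ n * halfPowSeries c p x := by
  rw [halfPowSeries, halfPowSeries, ← tsum_mul_left]
  exact tsum_congr fun k => by ring

lemma halfPowSeries_succ (c : ℕ → ℝ) (p : ℕ) (x : ℝ) :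
    halfPowSeries c (p + 1) x = x / 2 * halfPowSeries c p x := by
  rw [halfPowSeries_add_order, pow_one]

lemma halfPowSeries_neg (c : ℕ → ℝ) (p : ℕ) (x : ℝ) :
    halfPowSeries (fun k => -c k) p x = -halfPowSeries c p x := by
  simp only [halfPowSeries, neg_mul, tsum_neg]

lemma halfPowSeries_zero_apply_zero (c : ℕ → ℝ) : halfPowSeries c 0 0 = c 0 := by
  rw [halfPowSeries, tsum_eq_single 0 fun k hk => by simp [hk]]
  simp

lemma halfPowSeries_succ_apply_zero (c : ℕ → ℝ) (p : ℕ) : halfPowSeries c (p + 1) 0 = 0 := by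
  rw [halfPowSeries_succ, zero_div, zero_mul]

lemma IsEntireCoeff.tendsto_halfPowSeries_succ {c : ℕ → ℝ} (hc : IsEntireCoeff c) (p : ℕ) :
    Tendsto (halfPowSeries c (p + 1)) (𝓝[>] 0) (𝓝 0) :=
  ((hc.continuous_halfPowSeries _).tendsto' 0 0 (halfPowSeries_succ_apply_zero c p)).mono_left
    nhdsWithin_le_nhds

/-! ### Struve and Bessel functions of integer order -/

/-- The coefficients of the Struve function, `𝐇_m(x) = ∑_k struveCoeff m k (x/2)^{2k+m+1}`. As they
do not involve the power of `x/2`, they also serve for `𝓗_m` and `x^m 𝐇_m`. -/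
def struveCoeff (m k : ℕ) : ℝ :=
  (-1) ^ k / (Real.Gamma (k + 3 / 2) * Real.Gamma (k + m + 3 / 2))

/-- The coefficients of the Bessel function, `J_m(x) = ∑_k besselJCoeff m k (x/2)^{2k+m}`. -/
def besselJCoeff (m k : ℕ) : ℝ := (-1) ^ k / ((k.factorial : ℝ) * ((m + k).factorial : ℝ))

/-- The coefficients of the digamma series `∑_k digammaCoeff m k (x/2)^{2k+m}` subtracted in
`π Y_m(x)`. -/
def digammaCoeff (m k : ℕ) : ℝ :=
  (digammaSucc k + digammaSucc (m + k)) * (-1) ^ k /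
    ((k.factorial : ℝ) * ((m + k).factorial : ℝ))

/-- The polynomial subtracted in `(x/2)^m π Y_m(x)`; the factor `(x/2)^m` removes the pole. -/
def besselYPoly (m : ℕ) (x : ℝ) : ℝ :=
  ∑ k ∈ Finset.range m, ((m - k - 1).factorial : ℝ) / (k.factorial : ℝ) * (x ^ 2 / 4) ^ k

lemma half_factorial_le_Gamma (k : ℕ) : (k.factorial : ℝ) / 2 ≤ Real.Gamma (k + 3 / 2) := by
  have h : Real.Gamma (k + 2) ≤ Real.Gamma (k + 3 / 2 + 1) := by
    have : (0 : ℝ) ≤ k := k.cast_nonneg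
    exact Real.Gamma_strictMonoOn_Ici.monotoneOn (mem_Ici.2 (by linarith))
      (mem_Ici.2 (by linarith)) (by linarith)
  rw [Real.Gamma_add_one (by positivity),
    show (k : ℝ) + 2 = ((k + 1 : ℕ) : ℝ) + 1 by push_cast; ring,
    Real.Gamma_nat_eq_factorial, Nat.factorial_succ] at h
  push_cast at h
  refine le_of_mul_le_mul_left (a := (k : ℝ) + 3 / 2) (le_trans ?_ h) (by positivity)
  nlinarith [(by positivity : (0 : ℝ) < k.factorial), (k.cast_nonneg : (0 : ℝ) ≤ k)]

lemma isEntireCoeff_struveCoeff (m : ℕ) : IsEntireCoeff (struveCoeff m) :=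
  .of_abs_le (C := 4) fun k => by
    have hm : 1 / 2 ≤ Real.Gamma (k + m + 3 / 2) := by
      have h := half_factorial_le_Gamma (k + m)
      have hf : (1 : ℝ) ≤ (k + m).factorial := by exact_mod_cast Nat.factorial_pos _
      push_cast at h
      linarith
    have h : (k.factorial : ℝ) / 2 * (1 / 2) ≤
        Real.Gamma (k + 3 / 2) * Real.Gamma (k + m + 3 / 2) := by
      have hk := half_factorial_le_Gamma k
      gcongr
    have hpos := lt_of_lt_of_le (by positivity) h
    rw [struveCoeff, abs_div, abs_neg_one_pow, abs_of_pos hpos,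
      div_le_div_iff₀ hpos (by positivity)]
    linarith

lemma isEntireCoeff_besselJCoeff (m : ℕ) : IsEntireCoeff (besselJCoeff m) :=
  .of_abs_le (C := 1) fun k => by
    rw [besselJCoeff, abs_div, abs_neg_one_pow, abs_of_pos (by positivity)]
    have hf : (1 : ℝ) ≤ (m + k).factorial := by exact_mod_cast Nat.factorial_pos _
    exact one_div_le_one_div_of_le (by positivity) (le_mul_of_one_le_right (by positivity) hf)

lemma harmonic_le_self (k : ℕ) : (harmonic k : ℝ) ≤ k := by
  induction k with
  | zero => simp
  | succ k ih =>
    rw [harmonic_succ]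
    push_cast
    have h : ((k : ℝ) + 1)⁻¹ ≤ 1 := inv_le_one_of_one_le₀ (by linarith [k.cast_nonneg (α := ℝ)])
    linarith

lemma abs_digammaSucc_le (k : ℕ) : |digammaSucc k| ≤ k + 1 := by
  have h₀ : (0 : ℝ) ≤ harmonic k := by
    rw [harmonic]; push_cast; positivity
  rw [digammaSucc, abs_le]
  constructor <;> linarith [harmonic_le_self k, Real.one_half_lt_eulerMascheroniConstant,
    Real.eulerMascheroniConstant_lt_two_thirds]

lemma digammaSucc_succ (k : ℕ) : digammaSucc (k + 1) = digammaSucc k + 1 / (k + 1) := by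
  rw [digammaSucc, digammaSucc, harmonic_succ]
  push_cast
  ring

lemma isEntireCoeff_digammaCoeff (m : ℕ) : IsEntireCoeff (digammaCoeff m) :=
  .of_abs_le (C := 4) fun k => by
    have h : |digammaSucc k + digammaSucc (m + k)| ≤ 4 * (m + k).factorial := by
      have h₁ := abs_digammaSucc_le k
      have h₂ := abs_digammaSucc_le (m + k)
      have hf : (1 : ℝ) ≤ (m + k).factorial := by exact_mod_cast Nat.factorial_pos _
      have hf' : (m : ℝ) + k ≤ (m + k).factorial := by exact_mod_cast Nat.self_le_factorial _
      push_cast at h₂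
      linarith [abs_add_le (digammaSucc k) (digammaSucc (m + k)), m.cast_nonneg (α := ℝ)]
    rw [digammaCoeff, abs_div, abs_mul, abs_neg_one_pow, mul_one,
      abs_of_pos (by positivity : (0 : ℝ) < k.factorial * (m + k).factorial),
      div_le_div_iff₀ (by positivity) (by positivity)]
    nlinarith [(by positivity : (0 : ℝ) < k.factorial)]

lemma struveCoeff_succ_mul (m k : ℕ) :
    struveCoeff (m + 1) k * (k + m + 3 / 2) = struveCoeff m k := by
  have h : Real.Gamma (k + (m + 1 : ℕ) + 3 / 2) =
      (k + m + 3 / 2) * Real.Gamma (k + m + 3 / 2) := by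
    rw [← Real.Gamma_add_one (by positivity)]
    push_cast
    ring_nf
  have : 0 < Real.Gamma (k + m + 3 / 2) := Real.Gamma_pos_of_pos (by positivity)
  rw [struveCoeff, struveCoeff, h]
  field_simp

lemma struveCoeff_zero_zero : struveCoeff 0 0 = 4 / Real.pi := by
  have hG : Real.Gamma (3 / 2) = √Real.pi / 2 := by
    rw [show (3 / 2 : ℝ) = 1 / 2 + 1 by norm_num, Real.Gamma_add_one (by norm_num),
      Real.Gamma_one_half_eq]
    ring
  have hp : √Real.pi * √Real.pi = Real.pi := Real.mul_self_sqrt Real.pi_pos.le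
  simp only [struveCoeff, Nat.cast_zero, zero_add, pow_zero, hG, div_mul_div_comm, hp]
  norm_num

lemma struveCoeff_zero_succ_mul (k : ℕ) :
    struveCoeff 0 (k + 1) * (k + 3 / 2) = -struveCoeff 1 k := by
  have h : Real.Gamma (k + 1 + 3 / 2) = (k + 3 / 2) * Real.Gamma (k + 3 / 2) := by
    rw [← Real.Gamma_add_one (by positivity)]
    ring_nf
  have : 0 < Real.Gamma (k + 3 / 2) := Real.Gamma_pos_of_pos (by positivity)
  rw [struveCoeff, struveCoeff]
  push_cast
  rw [add_zero, h]
  field_simp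
  ring

lemma besselJCoeff_succ_mul (m k : ℕ) :
    besselJCoeff (m + 1) k * (k + m + 1) = besselJCoeff m k := by
  rw [besselJCoeff, besselJCoeff, add_right_comm, Nat.factorial_succ]
  push_cast
  field_simp
  ring

lemma succ_mul_besselJCoeff_zero_succ (k : ℕ) :
    (k + 1) * besselJCoeff 0 (k + 1) = -besselJCoeff 1 k := by
  simp only [besselJCoeff, zero_add, add_comm 1 k, Nat.factorial_succ]
  push_cast
  field_simp
  ring

lemma digammaCoeff_succ_mul (m k : ℕ) :
    digammaCoeff (m + 1) k * (k + m + 1) = digammaCoeff m k + besselJCoeff (m + 1) k := by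
  rw [digammaCoeff, digammaCoeff, besselJCoeff, add_right_comm, Nat.factorial_succ,
    digammaSucc_succ]
  push_cast
  field_simp
  ring

lemma succ_mul_digammaCoeff_zero_succ (k : ℕ) :
    (k + 1) * digammaCoeff 0 (k + 1) = -digammaCoeff 1 k + besselJCoeff 0 (k + 1) := by
  simp only [digammaCoeff, besselJCoeff, zero_add, add_comm 1 k, Nat.factorial_succ,
    digammaSucc_succ]
  push_cast
  field_simp
  ring

lemma struveH_natCast (m : ℕ) (x : ℝ) :
    struveH m x = halfPowSeries (struveCoeff m) (m + 1) x := by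
  refine tsum_congr fun k => ?_
  rw [show 2 * (k : ℝ) + m + 1 = ((2 * k + (m + 1) : ℕ) : ℝ) by push_cast; ring,
    Real.rpow_natCast, struveCoeff]
  ring

lemma scaledStruve_natCast (r : ℕ) {x : ℝ} (hx : 0 < x) :
    scaledStruve r x = halfPowSeries (struveCoeff r) 1 x := by
  rw [scaledStruve, struveH_natCast, add_comm, halfPowSeries_add_order,
    Real.rpow_neg (by positivity), Real.rpow_natCast, inv_mul_cancel_left₀ (by positivity)]

lemma besselJ_eq_halfPowSeries (m : ℕ) (x : ℝ) :
    besselJ m x = halfPowSeries (besselJCoeff m) m x :=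
  tsum_congr fun k => by rw [besselJCoeff]; ring

lemma besselY_eq (m : ℕ) (x : ℝ) :
    besselY m x = (2 * Real.log (x / 2) * halfPowSeries (besselJCoeff m) m x -
      ((x / 2) ^ m)⁻¹ * besselYPoly m x - halfPowSeries (digammaCoeff m) m x) / Real.pi := by
  have h : (x / 2) ^ m * ∑' k : ℕ, (digammaSucc k + digammaSucc (m + k)) *
      (-(x ^ 2 / 4)) ^ k / ((k.factorial : ℝ) * ((m + k).factorial : ℝ)) =
        halfPowSeries (digammaCoeff m) m x := by
    rw [halfPowSeries, ← tsum_mul_left]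
    refine tsum_congr fun k => ?_
    rw [digammaCoeff, neg_pow (x ^ 2 / 4), show x ^ 2 / 4 = (x / 2) ^ 2 by ring, ← pow_mul]
    ring
  rw [besselY, h, besselJ_eq_halfPowSeries, besselYPoly]

lemma scaledK_eq (m : ℕ) {x : ℝ} (hx : 0 < x) :
    scaledK m x = 2 ^ m * (halfPowSeries (struveCoeff m) (2 * m + 1) x -
      (2 * Real.log (x / 2) * halfPowSeries (besselJCoeff m) (2 * m) x - besselYPoly m x -
        halfPowSeries (digammaCoeff m) (2 * m) x) / Real.pi) := by
  have h : x ^ m = 2 ^ m * (x / 2) ^ m := by rw [← mul_pow, mul_div_cancel₀ x two_ne_zero]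
  have h2 : 2 * m = m + m := two_mul m
  rw [scaledK, struveK, struveH_natCast, besselY_eq, h, h2, add_right_comm,
    halfPowSeries_add_order _ (m + 1), halfPowSeries_add_order (besselJCoeff m),
    halfPowSeries_add_order (digammaCoeff m)]
  field_simp

lemma hasDerivAt_struveSeries_succ (m : ℕ) (x : ℝ) :
    HasDerivAt (halfPowSeries (struveCoeff (m + 1)) (2 * (m + 1) + 1))
      (x / 2 * halfPowSeries (struveCoeff m) (2 * m + 1) x) x := by
  refine ((isEntireCoeff_struveCoeff (m + 1)).hasDerivAt_halfPowSeries_succ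
    (2 * (m + 1)) x).congr_deriv ?_
  rw [← halfPowSeries_succ]
  refine tsum_congr fun k => ?_
  rw [← struveCoeff_succ_mul m k]
  push_cast
  ring

lemma hasDerivAt_besselJSeries_succ (m : ℕ) (x : ℝ) :
    HasDerivAt (halfPowSeries (besselJCoeff (m + 1)) (2 * (m + 1)))
      (x / 2 * halfPowSeries (besselJCoeff m) (2 * m) x) x := by
  refine ((isEntireCoeff_besselJCoeff (m + 1)).hasDerivAt_halfPowSeries_succ
    (2 * m + 1) x).congr_deriv ?_
  rw [← halfPowSeries_succ]
  refine tsum_congr fun k => ?_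
  rw [← besselJCoeff_succ_mul m k]
  push_cast
  ring

lemma hasDerivAt_digammaSeries_succ (m : ℕ) (x : ℝ) :
    HasDerivAt (halfPowSeries (digammaCoeff (m + 1)) (2 * (m + 1)))
      (x / 2 * halfPowSeries (digammaCoeff m) (2 * m) x +
        halfPowSeries (besselJCoeff (m + 1)) (2 * m + 1) x) x := by
  refine ((isEntireCoeff_digammaCoeff (m + 1)).hasDerivAt_halfPowSeries_succ
    (2 * m + 1) x).congr_deriv ?_
  rw [← halfPowSeries_succ, ← (isEntireCoeff_digammaCoeff m).halfPowSeries_add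
    (isEntireCoeff_besselJCoeff (m + 1))]
  refine tsum_congr fun k => ?_
  beta_reduce
  rw [← digammaCoeff_succ_mul m k]
  push_cast
  ring

lemma hasDerivAt_besselYPoly_succ (m : ℕ) (x : ℝ) :
    HasDerivAt (besselYPoly (m + 1)) (x / 2 * besselYPoly m x) x := by
  have h : HasDerivAt (besselYPoly (m + 1)) (∑ k ∈ Finset.range (m + 1),
      ((m + 1 - k - 1).factorial : ℝ) / (k.factorial : ℝ) *
        (k * (x ^ 2 / 4) ^ (k - 1) * (x / 2))) x := by
    refine HasDerivAt.fun_sum fun k _ => HasDerivAt.const_mul _ ?_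
    refine (((hasDerivAt_pow 2 x).div_const 4).pow k).congr_deriv ?_
    push_cast
    ring
  refine h.congr_deriv ?_
  rw [Finset.sum_range_succ', besselYPoly, Finset.mul_sum]
  simp only [Nat.cast_zero, zero_mul, mul_zero, add_zero]
  refine Finset.sum_congr rfl fun k _ => ?_
  rw [show m + 1 - (k + 1) - 1 = m - k - 1 by lia, Nat.factorial_succ, Nat.add_sub_cancel]
  push_cast
  field_simp

lemma hasDerivAt_struveSeries_zero (x : ℝ) :
    HasDerivAt (halfPowSeries (struveCoeff 0) 1)
      (2 / Real.pi - halfPowSeries (struveCoeff 1) 2 x) x := by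
  refine ((isEntireCoeff_struveCoeff 0).hasDerivAt_halfPowSeries_succ 0 x).congr_deriv ?_
  rw [((isEntireCoeff_struveCoeff 0).mul_add (by positivity)).halfPowSeries_eq_add,
    sub_eq_add_neg, ← halfPowSeries_neg, struveCoeff_zero_zero]
  congr 1
  · push_cast
    ring
  · refine tsum_congr fun k => ?_
    beta_reduce
    rw [← struveCoeff_zero_succ_mul k]
    push_cast
    ring

lemma hasDerivAt_besselJSeries_zero (x : ℝ) :
    HasDerivAt (halfPowSeries (besselJCoeff 0) 0) (-halfPowSeries (besselJCoeff 1) 1 x) x := by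
  refine ((isEntireCoeff_besselJCoeff 0).hasDerivAt_halfPowSeries_zero x).congr_deriv ?_
  simp only [succ_mul_besselJCoeff_zero_succ, halfPowSeries_neg]

lemma besselJSeries_zero_eq (x : ℝ) :
    halfPowSeries (besselJCoeff 0) 0 x =
      1 + x / 2 * halfPowSeries (fun k => besselJCoeff 0 (k + 1)) 1 x := by
  rw [(isEntireCoeff_besselJCoeff 0).halfPowSeries_eq_add, ← halfPowSeries_succ]
  simp [besselJCoeff]

lemma hasDerivAt_digammaSeries_zero (x : ℝ) :
    HasDerivAt (halfPowSeries (digammaCoeff 0) 0)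
      (-halfPowSeries (digammaCoeff 1) 1 x +
        halfPowSeries (fun k => besselJCoeff 0 (k + 1)) 1 x) x := by
  refine ((isEntireCoeff_digammaCoeff 0).hasDerivAt_halfPowSeries_zero x).congr_deriv ?_
  have hneg : IsEntireCoeff fun k => -digammaCoeff 1 k := fun r => by
    simpa only [neg_mul] using (isEntireCoeff_digammaCoeff 1 r).neg
  simp only [succ_mul_digammaCoeff_zero_succ]
  rw [hneg.halfPowSeries_add (isEntireCoeff_besselJCoeff 0).comp_succ, halfPowSeries_neg]

lemma hasDerivAt_log_div_const {x c : ℝ} (hx : x ≠ 0) (hc : c ≠ 0) :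
    HasDerivAt (fun x : ℝ => Real.log (x / c)) (1 / x) x := by
  refine (((hasDerivAt_id' x).div_const c).log (div_ne_zero hx hc)).congr_deriv ?_
  field_simp

lemma hasDerivAt_scaledK_succ (m : ℕ) {x : ℝ} (hx : 0 < x) :
    HasDerivAt (scaledK (m + 1)) (x * scaledK m x) x := by
  have h := ((hasDerivAt_struveSeries_succ m x).sub
    ((((((hasDerivAt_log_div_const hx.ne' two_ne_zero).const_mul 2).mul
      (hasDerivAt_besselJSeries_succ m x)).sub (hasDerivAt_besselYPoly_succ m x)).sub
        (hasDerivAt_digammaSeries_succ m x)).div_const Real.pi)).const_mul (2 ^ (m + 1) : ℝ)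
  refine (h.congr_of_eventuallyEq ?_).congr_deriv ?_
  · filter_upwards [lt_mem_nhds hx] with y hy
    exact scaledK_eq _ hy
  · rw [scaledK_eq m hx, mul_add_one, halfPowSeries_succ (besselJCoeff (m + 1))]
    field_simp
    ring

lemma hasDerivAt_scaledK_zero {x : ℝ} (hx : 0 < x) :
    HasDerivAt (scaledK 0) (2 / Real.pi - scaledK 1 x / x) x := by
  have h := ((hasDerivAt_struveSeries_zero x).sub
    (((((hasDerivAt_log_div_const hx.ne' two_ne_zero).const_mul 2).mul
      (hasDerivAt_besselJSeries_zero x)).sub (hasDerivAt_digammaSeries_zero x)).div_const Real.pi))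
  refine (h.congr_of_eventuallyEq ?_).congr_deriv ?_
  · filter_upwards [lt_mem_nhds hx] with y hy
    rw [scaledK_eq _ hy]
    simp [besselYPoly]
  · have hH : halfPowSeries (struveCoeff 1) (2 * 1 + 1) x =
        x / 2 * halfPowSeries (struveCoeff 1) 2 x := halfPowSeries_succ _ _ _
    have hJ : halfPowSeries (besselJCoeff 1) (2 * 1) x =
        x / 2 * halfPowSeries (besselJCoeff 1) 1 x := halfPowSeries_succ _ _ _
    have hψ : halfPowSeries (digammaCoeff 1) (2 * 1) x =
        x / 2 * halfPowSeries (digammaCoeff 1) 1 x := halfPowSeries_succ _ _ _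
    rw [scaledK_eq 1 hx, besselJSeries_zero_eq, hH, hJ, hψ]
    simp only [besselYPoly, Finset.range_one, Finset.sum_singleton, tsub_self, Nat.sub_zero,
      Nat.factorial_zero, Nat.cast_one, pow_zero, pow_one, div_one, mul_one]
    field_simp
    ring

lemma tendsto_log_div_mul_of_hasDerivAt {f : ℝ → ℝ} {f' c : ℝ} (hc : c ≠ 0)
    (hf : HasDerivAt f f' 0) (h₀ : f 0 = 0) :
    Tendsto (fun x : ℝ => Real.log (x / c) * f x) (𝓝[>] 0) (𝓝 0) := by
  have hslope : Tendsto (fun x : ℝ => x⁻¹ * f x) (𝓝[>] 0) (𝓝 f') := by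
    simpa [h₀] using hf.tendsto_slope_zero_right
  have hlog : Tendsto (fun x : ℝ => Real.log x * x) (𝓝[>] 0) (𝓝 0) := by
    simpa using tendsto_log_mul_rpow_nhdsGT_zero one_pos
  have hconst : Tendsto (fun x => Real.log c * f x) (𝓝[>] 0) (𝓝 0) := by
    simpa [h₀] using (hf.continuousAt.tendsto.mono_left nhdsWithin_le_nhds).const_mul (Real.log c)
  have h := (hlog.mul hslope).sub hconst
  rw [zero_mul, sub_zero] at h
  refine h.congr' ?_
  filter_upwards [self_mem_nhdsWithin] with x (hx : 0 < x)
  rw [Real.log_div hx.ne' hc]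
  field_simp

lemma tendsto_scaledK_succ (m : ℕ) :
    Tendsto (scaledK (m + 1)) (𝓝[>] 0) (𝓝 (2 ^ (m + 1) * (m.factorial / Real.pi))) := by
  have hH := (isEntireCoeff_struveCoeff (m + 1)).tendsto_halfPowSeries_succ (2 * (m + 1))
  have hJ := tendsto_log_div_mul_of_hasDerivAt two_ne_zero (hasDerivAt_besselJSeries_succ m 0)
    (halfPowSeries_succ_apply_zero _ _)
  have hψ : Tendsto (halfPowSeries (digammaCoeff (m + 1)) (2 * (m + 1))) (𝓝[>] 0) (𝓝 0) :=
    (isEntireCoeff_digammaCoeff (m + 1)).tendsto_halfPowSeries_succ (2 * m + 1)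
  have hP : Tendsto (besselYPoly (m + 1)) (𝓝[>] 0) (𝓝 m.factorial) := by
    have h₀ : besselYPoly (m + 1) 0 = m.factorial := by
      rw [besselYPoly, Finset.sum_range_succ']
      simp
    exact h₀ ▸ (hasDerivAt_besselYPoly_succ m 0).continuousAt.tendsto.mono_left nhdsWithin_le_nhds
  have h := (hH.sub ((((hJ.const_mul 2).sub hP).sub hψ).div_const Real.pi)).const_mul
    (2 ^ (m + 1) : ℝ)
  rw [show (0 : ℝ) - (2 * 0 - m.factorial - 0) / Real.pi = m.factorial / Real.pi by ring] at h
  refine h.congr' ?_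
  filter_upwards [self_mem_nhdsWithin] with x hx
  rw [scaledK_eq _ hx, mul_assoc 2]

lemma tendsto_scaledK_zero :
    Tendsto (fun x => scaledK 0 x + 2 / Real.pi * Real.log x) (𝓝[>] 0)
      (𝓝 (2 / Real.pi * (Real.log 2 - Real.eulerMascheroniConstant))) := by
  have hH := (isEntireCoeff_struveCoeff 0).tendsto_halfPowSeries_succ (2 * 0)
  have hJ := tendsto_log_div_mul_of_hasDerivAt two_ne_zero
    ((hasDerivAt_besselJSeries_zero 0).sub_const 1) (by simp [besselJSeries_zero_eq])
  have hψ : Tendsto (halfPowSeries (digammaCoeff 0) (2 * 0)) (𝓝[>] 0)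
      (𝓝 (-2 * Real.eulerMascheroniConstant)) :=
    (((isEntireCoeff_digammaCoeff 0).continuous_halfPowSeries 0).tendsto' 0 _ <| by
      rw [halfPowSeries_zero_apply_zero, digammaCoeff, digammaSucc, harmonic_zero, Rat.cast_zero,
        pow_zero, add_zero, Nat.factorial_zero, Nat.cast_one]
      ring).mono_left nhdsWithin_le_nhds
  have h := (hH.sub (((hJ.const_mul 2).sub hψ).div_const Real.pi)).add_const
    (2 / Real.pi * Real.log 2)
  rw [show (0 - (2 * 0 - -2 * Real.eulerMascheroniConstant) / Real.pi) + 2 / Real.pi * Real.log 2 =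
      2 / Real.pi * (Real.log 2 - Real.eulerMascheroniConstant) by ring] at h
  refine h.congr' ?_
  filter_upwards [self_mem_nhdsWithin] with x (hx : 0 < x)
  rw [scaledK_eq _ hx, Real.log_div hx.ne' two_ne_zero]
  simp only [besselYPoly, Finset.range_zero, Finset.sum_empty]
  ring

/-! ### The Laplace-type integrals of `𝓚_m` -/

/-- The Laplace-type integral `∫_0^∞ (x² + s²)^p e^{-s} ds`. For `p = m - 1/2` it is a multiple of
`𝓚_m(x)` and, by the binomial theorem, a combination of `C_0(x), …, C_m(x)`. -/
def struveLaplace (p x : ℝ) : ℝ := ∫ s in Ioi (0 : ℝ), (x ^ 2 + s ^ 2) ^ p * Real.exp (-s)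

lemma continuous_sq_add_sq_rpow (p : ℝ) {x : ℝ} (hx : 0 < x) :
    Continuous fun s : ℝ => (x ^ 2 + s ^ 2) ^ p :=
  (by fun_prop : Continuous fun s : ℝ => x ^ 2 + s ^ 2).rpow_const
    fun s => Or.inl (by positivity)

lemma isBigO_sq_add_sq_rpow (p : ℝ) {x : ℝ} (hx : 0 < x) :
    (fun s : ℝ => (x ^ 2 + s ^ 2) ^ p) =O[atTop] fun s => Real.exp (1 / 2 * s) := by
  rcases le_total 0 p with hp | hp
  · have hpow : (fun s : ℝ => (x + s) ^ (2 * p)) =O[atTop] fun s => Real.exp (1 / 2 * (x + s)) :=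
      ((isLittleO_rpow_exp_pos_mul_atTop (2 * p) one_half_pos).comp_tendsto
        (tendsto_atTop_add_const_left _ x tendsto_id)).isBigO
    have hexp : (fun s : ℝ => Real.exp (1 / 2 * (x + s))) =O[atTop]
        fun s => Real.exp (1 / 2 * s) := by
      simp_rw [mul_add, Real.exp_add]
      exact Asymptotics.isBigO_const_mul_self _ _ _
    refine Asymptotics.IsBigO.trans (.of_bound 1 ?_) (hpow.trans hexp)
    filter_upwards [eventually_ge_atTop 0] with s hs
    rw [one_mul, Real.norm_of_nonneg (by positivity), Real.norm_of_nonneg (by positivity),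
      Real.rpow_mul (by positivity), Real.rpow_two]
    exact Real.rpow_le_rpow (by positivity) (by nlinarith) hp
  · refine .of_bound ((x ^ 2) ^ p) ?_
    filter_upwards [eventually_ge_atTop 0] with s hs
    rw [Real.norm_of_nonneg (by positivity), Real.norm_of_nonneg (by positivity)]
    calc (x ^ 2 + s ^ 2) ^ p ≤ (x ^ 2) ^ p :=
          Real.rpow_le_rpow_of_nonpos (by positivity) (by nlinarith [sq_nonneg s]) hp
      _ ≤ _ := le_mul_of_one_le_right (by positivity) (Real.one_le_exp (by positivity))

lemma isBigO_sq_add_sq_rpow_mul_exp_neg (p : ℝ) {x : ℝ} (hx : 0 < x) :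
    (fun s : ℝ => (x ^ 2 + s ^ 2) ^ p * Real.exp (-s)) =O[atTop]
      fun s => Real.exp (-(1 / 2) * s) := by
  refine ((isBigO_sq_add_sq_rpow p hx).mul (Asymptotics.isBigO_refl _ _)).congr_right fun s => ?_
  rw [← Real.exp_add]
  ring_nf

lemma integrableOn_sq_add_sq_rpow_mul_exp_neg (p : ℝ) {x : ℝ} (hx : 0 < x) :
    IntegrableOn (fun s : ℝ => (x ^ 2 + s ^ 2) ^ p * Real.exp (-s)) (Ioi 0) :=
  integrable_of_isBigO_exp_neg one_half_pos
    ((continuous_sq_add_sq_rpow p hx).mul (by fun_prop)).continuousOn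
    (isBigO_sq_add_sq_rpow_mul_exp_neg p hx)

lemma tendsto_sq_add_sq_rpow_mul_exp_neg (p : ℝ) {x : ℝ} (hx : 0 < x) :
    Tendsto (fun s : ℝ => (x ^ 2 + s ^ 2) ^ p * Real.exp (-s)) atTop (𝓝 0) :=
  (isBigO_sq_add_sq_rpow_mul_exp_neg p hx).trans_tendsto <|
    Real.tendsto_exp_atBot.comp (tendsto_id.const_mul_atTop_of_neg (by norm_num))

lemma rpow_le_rpow_add_rpow {a y b : ℝ} (ha : 0 < a) (hay : a ≤ y) (hyb : y ≤ b) (q : ℝ) :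
    y ^ q ≤ a ^ q + b ^ q := by
  have hy : 0 ≤ y := ha.le.trans hay
  rcases le_total 0 q with hq | hq
  · exact (Real.rpow_le_rpow hy hyb hq).trans (le_add_of_nonneg_left (by positivity))
  · exact (Real.rpow_le_rpow_of_nonpos ha hay hq).trans
      (le_add_of_nonneg_right (Real.rpow_nonneg (hy.trans hyb) q))

lemma hasDerivAt_struveLaplace (p : ℝ) {x : ℝ} (hx : 0 < x) :
    HasDerivAt (struveLaplace p) (2 * p * x * struveLaplace (p - 1) x) x := by
  have hint (q : ℝ) {y : ℝ} (hy : 0 < y) := integrableOn_sq_add_sq_rpow_mul_exp_neg q hy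
  have key := hasDerivAt_integral_of_dominated_loc_of_deriv_le (𝕜 := ℝ)
    (μ := volume.restrict (Ioi (0 : ℝ)))
    (F := fun (y s : ℝ) => (y ^ 2 + s ^ 2) ^ p * Real.exp (-s))
    (F' := fun (y s : ℝ) => 2 * p * y * ((y ^ 2 + s ^ 2) ^ (p - 1) * Real.exp (-s)))
    (s := Ioo (x / 2) (2 * x)) (x₀ := x)
    (bound := fun s => |2 * p| * (2 * x) *
      (((x / 2) ^ 2 + s ^ 2) ^ (p - 1) * Real.exp (-s) +
        ((2 * x) ^ 2 + s ^ 2) ^ (p - 1) * Real.exp (-s)))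
    (Ioo_mem_nhds (by linarith) (by linarith))
    (by filter_upwards [lt_mem_nhds hx] with y hy using (hint p hy).aestronglyMeasurable)
    (hint p hx) ((hint (p - 1) hx).const_mul _).aestronglyMeasurable
    (ae_of_all _ fun s y hy => ?_)
    (((hint (p - 1) (half_pos hx)).add (hint (p - 1) (by positivity))).const_mul _)
    (ae_of_all _ fun s y hy => ?_)
  · refine key.2.congr_deriv ?_
    rw [integral_const_mul, struveLaplace]
  · have hy₀ : 0 < y := (half_pos hx).trans hy.1
    have h := rpow_le_rpow_add_rpow (a := (x / 2) ^ 2 + s ^ 2) (y := y ^ 2 + s ^ 2)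
      (b := (2 * x) ^ 2 + s ^ 2) (by positivity) (by nlinarith [hy.1]) (by nlinarith [hy.2]) (p - 1)
    rw [norm_mul, norm_mul (2 * p), Real.norm_of_nonneg
      (by positivity : 0 ≤ (y ^ 2 + s ^ 2) ^ (p - 1) * Real.exp (-s)),
      Real.norm_of_nonneg hy₀.le, Real.norm_eq_abs, ← add_mul]
    have hyx := hy.2.le
    gcongr
  · have hy₀ : 0 < y := (half_pos hx).trans hy.1
    refine (((hasDerivAt_pow 2 y).add_const (s ^ 2)).rpow_const (p := p)
      (Or.inl (by positivity))).mul_const (Real.exp (-s)) |>.congr_deriv ?_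
    push_cast
    ring

lemma hasDerivAt_sq_add_sq_rpow (q : ℝ) {x : ℝ} (hx : 0 < x) (s : ℝ) :
    HasDerivAt (fun s : ℝ => (x ^ 2 + s ^ 2) ^ q) (2 * q * s * (x ^ 2 + s ^ 2) ^ (q - 1)) s := by
  refine (((hasDerivAt_pow 2 s).const_add (x ^ 2)).rpow_const (p := q)
    (Or.inl (by positivity))).congr_deriv ?_
  push_cast
  ring

lemma hasDerivAt_exp_neg (s : ℝ) : HasDerivAt (fun s : ℝ => Real.exp (-s)) (-Real.exp (-s)) s := by
  simpa using (hasDerivAt_neg s).exp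

lemma hasDerivAt_primitive_struveLaplace_recurrence (p : ℝ) {x : ℝ} (hx : 0 < x) (s : ℝ) :
    HasDerivAt (fun s : ℝ =>
        (2 * (p + 1) * (s * (x ^ 2 + s ^ 2) ^ p) + (x ^ 2 + s ^ 2) ^ (p + 1)) * Real.exp (-s))
      (2 * (p + 1) * (2 * p + 1) * ((x ^ 2 + s ^ 2) ^ p * Real.exp (-s)) -
        4 * p * (p + 1) * x ^ 2 * ((x ^ 2 + s ^ 2) ^ (p - 1) * Real.exp (-s)) -
        (x ^ 2 + s ^ 2) ^ (p + 1) * Real.exp (-s)) s := by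
  have hpos : 0 < x ^ 2 + s ^ 2 := by positivity
  refine (((((hasDerivAt_id' s).mul (hasDerivAt_sq_add_sq_rpow p hx s)).const_mul
    (2 * (p + 1))).add (hasDerivAt_sq_add_sq_rpow (p + 1) hx s)).mul
      (hasDerivAt_exp_neg s)).congr_deriv ?_
  have h : (x ^ 2 + s ^ 2) ^ p = (x ^ 2 + s ^ 2) ^ (p - 1) * (x ^ 2 + s ^ 2) := by
    rw [← Real.rpow_add_one hpos.ne', sub_add_cancel]
  simp only [Pi.add_apply, Pi.mul_apply]
  rw [add_sub_cancel_right, h]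
  ring

lemma self_mul_sq_add_sq_rpow_le (p : ℝ) {x s : ℝ} (hx : 0 < x) :
    s * (x ^ 2 + s ^ 2) ^ p ≤ (x ^ 2 + s ^ 2) ^ (p + 1 / 2) := by
  have h : s ≤ (x ^ 2 + s ^ 2) ^ (1 / 2 : ℝ) := by
    rw [← Real.sqrt_eq_rpow]
    exact Real.le_sqrt_of_sq_le (le_add_of_nonneg_left (sq_nonneg x))
  rw [Real.rpow_add (by positivity), mul_comm]
  gcongr

lemma tendsto_primitive_struveLaplace_recurrence (p : ℝ) {x : ℝ} (hx : 0 < x) :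
    Tendsto (fun s : ℝ =>
      (2 * (p + 1) * (s * (x ^ 2 + s ^ 2) ^ p) + (x ^ 2 + s ^ 2) ^ (p + 1)) * Real.exp (-s))
      atTop (𝓝 0) := by
  have h : Tendsto (fun s : ℝ => s * (x ^ 2 + s ^ 2) ^ p * Real.exp (-s)) atTop (𝓝 0) := by
    refine squeeze_zero' ?_ ?_ (tendsto_sq_add_sq_rpow_mul_exp_neg (p + 1 / 2) hx) <;>
      filter_upwards [eventually_ge_atTop 0] with s hs
    · positivity
    · gcongr
      exact self_mul_sq_add_sq_rpow_le p hx
  have h' := (h.const_mul (2 * (p + 1))).add (tendsto_sq_add_sq_rpow_mul_exp_neg (p + 1) hx)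
  rw [mul_zero, add_zero] at h'
  exact h'.congr fun s => by ring

lemma struveLaplace_add_one (p : ℝ) {x : ℝ} (hx : 0 < x) :
    struveLaplace (p + 1) x = x ^ (2 * (p + 1)) +
      2 * (p + 1) * (2 * p + 1) * struveLaplace p x -
      4 * p * (p + 1) * x ^ 2 * struveLaplace (p - 1) x := by
  have hint (q : ℝ) := integrableOn_sq_add_sq_rpow_mul_exp_neg q hx
  have h₁ := (hint p).const_mul (2 * (p + 1) * (2 * p + 1))
  have h₂ := (hint (p - 1)).const_mul (4 * p * (p + 1) * x ^ 2)
  have h := integral_Ioi_of_hasDerivAt_of_tendsto' (a := 0)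
    (fun s _ => hasDerivAt_primitive_struveLaplace_recurrence p hx s)
    ((h₁.sub h₂).sub (hint (p + 1))) (tendsto_primitive_struveLaplace_recurrence p hx)
  have hsub := integral_sub (h₁.sub h₂) (hint (p + 1))
  simp only [Pi.sub_apply] at hsub
  rw [hsub, integral_sub h₁ h₂, integral_const_mul, integral_const_mul, neg_zero, Real.exp_zero,
    zero_pow two_ne_zero, add_zero, zero_mul, mul_zero, zero_add, mul_one, ← Real.rpow_two x,
    ← Real.rpow_mul hx.le, Real.rpow_two x] at h
  simp only [← struveLaplace.eq_def] at h
  linarith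

lemma sq_mul_struveLaplace_neg_three_halves {x : ℝ} (hx : 0 < x) :
    x ^ 2 * struveLaplace (-1 / 2 - 1) x = struveLaplace (1 / 2) x - x := by
  have h := struveLaplace_add_one (-1 / 2) hx
  norm_num at h ⊢
  linarith

lemma tendsto_struveLaplace_of_pos {p : ℝ} (hp : 0 < p) :
    Tendsto (struveLaplace p) (𝓝[>] 0) (𝓝 (Real.Gamma (2 * p + 1))) := by
  rw [Real.Gamma_eq_integral (by positivity)]
  refine tendsto_integral_filter_of_dominated_convergence
    (fun s => (1 ^ 2 + s ^ 2) ^ p * Real.exp (-s)) ?_ ?_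
    (integrableOn_sq_add_sq_rpow_mul_exp_neg p one_pos)
    (ae_restrict_of_forall_mem measurableSet_Ioi fun s (hs : 0 < s) => ?_)
  · filter_upwards [self_mem_nhdsWithin] with y hy
    exact (integrableOn_sq_add_sq_rpow_mul_exp_neg p hy).aestronglyMeasurable
  · filter_upwards [Ioo_mem_nhdsGT one_pos] with y hy
    refine ae_of_all _ fun s => ?_
    rw [Real.norm_of_nonneg (by positivity)]
    obtain ⟨hy₀, hy₁⟩ := hy
    gcongr
  · have hc : ContinuousAt (fun y : ℝ => (y ^ 2 + s ^ 2) ^ p * Real.exp (-s)) 0 :=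
      (ContinuousAt.rpow_const (by fun_prop) (Or.inr hp.le)).mul continuousAt_const
    have h₀ : ((0 : ℝ) ^ 2 + s ^ 2) ^ p * Real.exp (-s) = Real.exp (-s) * s ^ (2 * p + 1 - 1) := by
      rw [add_sub_cancel_right, Real.rpow_mul hs.le, Real.rpow_two, zero_pow two_ne_zero, zero_add,
        mul_comm]
    exact h₀ ▸ hc.tendsto.mono_left nhdsWithin_le_nhds

lemma integral_log_mul_exp_neg :
    ∫ s in Ioi (0 : ℝ), Real.log s * Real.exp (-s) = -Real.eulerMascheroniConstant := by
  have hderiv : HasDerivAt Complex.GammaIntegral (-Real.eulerMascheroniConstant : ℂ) 1 := by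
    refine Complex.hasDerivAt_Gamma_one.congr_of_eventuallyEq ?_
    have hopen : IsOpen {s : ℂ | 0 < s.re} := Complex.continuous_re.isOpen_preimage _ isOpen_Ioi
    filter_upwards [hopen.mem_nhds (by simp : (1 : ℂ) ∈ {s : ℂ | 0 < s.re})] with a ha
    exact (Complex.Gamma_eq_integral ha).symm
  have h := (Complex.hasDerivAt_GammaIntegral (s := 1) (by simp)).unique hderiv
  simp only [sub_self, Complex.cpow_zero, one_mul] at h
  rw [← Complex.ofReal_inj, ← integral_complex_ofReal]
  push_cast at h ⊢
  exact h

lemma integrableOn_log_mul_exp_neg :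
    IntegrableOn (fun s : ℝ => Real.log s * Real.exp (-s)) (Ioi 0) := by
  -- the Bochner integral of a non-integrable function is `0`, and `γ ≠ 0`
  by_contra h
  have h₀ := integral_log_mul_exp_neg
  rw [integral_undef h] at h₀
  linarith [Real.one_half_lt_eulerMascheroniConstant]

lemma integrableOn_exp_neg : IntegrableOn (fun s : ℝ => Real.exp (-s)) (Ioi 0) := by
  simpa using exp_neg_integrableOn_Ioi 0 one_pos

lemma integrableOn_self_mul_exp_neg : IntegrableOn (fun s : ℝ => s * Real.exp (-s)) (Ioi 0) :=
  (Real.GammaIntegral_convergent two_pos).congr_fun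
    (fun s _ => by norm_num [mul_comm]) measurableSet_Ioi

lemma integral_log_two_mul_mul_exp_neg :
    ∫ s in Ioi (0 : ℝ), Real.log (2 * s) * Real.exp (-s) =
      Real.log 2 - Real.eulerMascheroniConstant := by
  calc ∫ s in Ioi (0 : ℝ), Real.log (2 * s) * Real.exp (-s)
      = ∫ s in Ioi (0 : ℝ), (Real.log 2 * Real.exp (-s) + Real.log s * Real.exp (-s)) :=
        setIntegral_congr_fun measurableSet_Ioi fun s (hs : 0 < s) => by
          rw [Real.log_mul two_ne_zero hs.ne', add_mul]
    _ = Real.log 2 - Real.eulerMascheroniConstant := by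
        rw [integral_add (integrableOn_exp_neg.const_mul _) integrableOn_log_mul_exp_neg,
          integral_const_mul, integral_exp_neg_Ioi_zero, integral_log_mul_exp_neg, mul_one,
          sub_eq_add_neg]

lemma abs_log_add_sqrt_le {c x s : ℝ} (hc : 0 < c) (hcs : c ≤ s + √(x ^ 2 + s ^ 2))
    (hx : 0 ≤ x) (hs : 0 ≤ s) : |Real.log (s + √(x ^ 2 + s ^ 2))| ≤ |Real.log c| + x + 2 * s := by
  have hsqrt : √(x ^ 2 + s ^ 2) ≤ x + s := Real.sqrt_le_iff.2 ⟨by positivity, by nlinarith⟩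
  have hlower := Real.log_le_log hc hcs
  have hupper := Real.log_le_sub_one_of_pos (hc.trans_le hcs)
  rw [abs_le]
  constructor <;> linarith [neg_abs_le (Real.log c), abs_nonneg (Real.log c)]

lemma norm_log_add_sqrt_mul_exp_neg_le {c x s : ℝ} (hc : 0 < c)
    (hcs : c ≤ s + √(x ^ 2 + s ^ 2)) (hx : 0 ≤ x) (hs : 0 ≤ s) :
    ‖Real.log (s + √(x ^ 2 + s ^ 2)) * Real.exp (-s)‖ ≤
      (|Real.log c| + x) * Real.exp (-s) + 2 * (s * Real.exp (-s)) := by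
  rw [norm_mul, Real.norm_of_nonneg (Real.exp_pos _).le, Real.norm_eq_abs, ← mul_assoc, ← add_mul]
  gcongr
  exact abs_log_add_sqrt_le hc hcs hx hs

lemma le_add_sqrt_sq_add_sq {x s : ℝ} (hs : 0 ≤ s) : x ≤ s + √(x ^ 2 + s ^ 2) :=
  (Real.le_sqrt_of_sq_le (le_add_of_nonneg_right (sq_nonneg s))).trans (le_add_of_nonneg_left hs)

lemma hasDerivAt_log_add_sqrt {x : ℝ} (hx : 0 < x) {s : ℝ} (hs : 0 ≤ s) :
    HasDerivAt (fun s : ℝ => Real.log (s + √(x ^ 2 + s ^ 2)))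
      ((x ^ 2 + s ^ 2) ^ (-1 / 2 : ℝ)) s := by
  have hpos : 0 < x ^ 2 + s ^ 2 := by positivity
  have : 0 < √(x ^ 2 + s ^ 2) := Real.sqrt_pos.2 hpos
  refine (((hasDerivAt_id' s).add (((hasDerivAt_pow 2 s).const_add (x ^ 2)).sqrt hpos.ne')).log
    (show s + √(x ^ 2 + s ^ 2) ≠ 0 by positivity)).congr_deriv ?_
  rw [neg_div, Real.rpow_neg hpos.le, ← Real.sqrt_eq_rpow]
  simp only [Pi.add_apply]
  push_cast
  field_simp
  ring

lemma integrableOn_log_add_sqrt_mul_exp_neg {x : ℝ} (hx : 0 < x) :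
    IntegrableOn (fun s : ℝ => Real.log (s + √(x ^ 2 + s ^ 2)) * Real.exp (-s)) (Ioi 0) := by
  have hcont : ContinuousOn (fun s : ℝ => Real.log (s + √(x ^ 2 + s ^ 2)) * Real.exp (-s))
      (Ioi 0) := fun s hs =>
    ((hasDerivAt_log_add_sqrt hx (le_of_lt hs)).continuousAt.mul
      (by fun_prop)).continuousWithinAt
  exact Integrable.mono' ((integrableOn_exp_neg.const_mul (|Real.log x| + x)).add
    (integrableOn_self_mul_exp_neg.const_mul 2)) (hcont.aestronglyMeasurable measurableSet_Ioi)
    (ae_restrict_of_forall_mem measurableSet_Ioi fun s (hs : 0 < s) =>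
      norm_log_add_sqrt_mul_exp_neg_le hx (le_add_sqrt_sq_add_sq hs.le) hx.le hs.le)

lemma tendsto_log_add_sqrt_mul_exp_neg {x : ℝ} (hx : 0 < x) :
    Tendsto (fun s : ℝ => Real.log (s + √(x ^ 2 + s ^ 2)) * Real.exp (-s)) atTop (𝓝 0) := by
  have h := (Real.tendsto_exp_neg_atTop_nhds_zero.const_mul (|Real.log x| + x)).add
    ((Real.tendsto_pow_mul_exp_neg_atTop_nhds_zero 1).const_mul 2)
  simp only [pow_one, mul_zero, add_zero] at h
  refine squeeze_zero_norm' ?_ h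
  filter_upwards [eventually_ge_atTop 0] with s hs
  exact norm_log_add_sqrt_mul_exp_neg_le hx (le_add_sqrt_sq_add_sq hs) hx.le hs

lemma struveLaplace_neg_half_add_log {x : ℝ} (hx : 0 < x) :
    struveLaplace (-1 / 2) x + Real.log x =
      ∫ s in Ioi (0 : ℝ), Real.log (s + √(x ^ 2 + s ^ 2)) * Real.exp (-s) := by
  have hd : ∀ s ∈ Ici (0 : ℝ), HasDerivAt
      (fun s : ℝ => Real.log (s + √(x ^ 2 + s ^ 2)) * Real.exp (-s))
      ((x ^ 2 + s ^ 2) ^ (-1 / 2 : ℝ) * Real.exp (-s) -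
        Real.log (s + √(x ^ 2 + s ^ 2)) * Real.exp (-s)) s := fun s hs => by
    refine ((hasDerivAt_log_add_sqrt hx hs).mul (hasDerivAt_exp_neg s)).congr_deriv ?_
    ring
  have hi := integrableOn_sq_add_sq_rpow_mul_exp_neg (-1 / 2) hx
  have hlog := integrableOn_log_add_sqrt_mul_exp_neg hx
  have h := integral_Ioi_of_hasDerivAt_of_tendsto' hd (hi.sub hlog)
    (tendsto_log_add_sqrt_mul_exp_neg hx)
  rw [integral_sub hi hlog, zero_add, neg_zero, Real.exp_zero, zero_pow two_ne_zero, add_zero,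
    Real.sqrt_sq hx.le, mul_one, ← struveLaplace] at h
  linarith

lemma tendsto_integral_log_add_sqrt_mul_exp_neg :
    Tendsto (fun x : ℝ => ∫ s in Ioi (0 : ℝ), Real.log (s + √(x ^ 2 + s ^ 2)) * Real.exp (-s))
      (𝓝[>] 0) (𝓝 (∫ s in Ioi (0 : ℝ), Real.log (2 * s) * Real.exp (-s))) := by
  refine tendsto_integral_filter_of_dominated_convergence
    (fun s => |Real.log s| * Real.exp (-s) + (1 * Real.exp (-s) + 2 * (s * Real.exp (-s)))) ?_ ?_
    ?_ (ae_restrict_of_forall_mem measurableSet_Ioi fun s (hs : 0 < s) => ?_)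
  · filter_upwards [self_mem_nhdsWithin] with y hy
    exact (integrableOn_log_add_sqrt_mul_exp_neg hy).aestronglyMeasurable
  · filter_upwards [Ioo_mem_nhdsGT one_pos] with y ⟨hy₀, hy₁⟩
    refine ae_restrict_of_forall_mem measurableSet_Ioi fun s (hs : 0 < s) => ?_
    refine (norm_log_add_sqrt_mul_exp_neg_le hs (le_add_of_nonneg_right (Real.sqrt_nonneg _))
      hy₀.le hs.le).trans ?_
    rw [add_mul, add_assoc]
    gcongr
  · refine Integrable.add ?_ ((integrableOn_exp_neg.const_mul 1).add
      (integrableOn_self_mul_exp_neg.const_mul 2))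
    exact integrableOn_log_mul_exp_neg.norm.congr <| ae_of_all _ fun s => by
      beta_reduce
      rw [norm_mul, Real.norm_of_nonneg (Real.exp_pos _).le, Real.norm_eq_abs]
  · have hc : ContinuousAt (fun y : ℝ => Real.log (s + √(y ^ 2 + s ^ 2)) * Real.exp (-s)) 0 :=
      (ContinuousAt.log (by fun_prop) (by positivity)).mul continuousAt_const
    have h₀ : s + √((0 : ℝ) ^ 2 + s ^ 2) = 2 * s := by
      rw [zero_pow two_ne_zero, zero_add, Real.sqrt_sq hs.le, two_mul]
    exact h₀ ▸ hc.tendsto.mono_left nhdsWithin_le_nhds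

lemma tendsto_struveLaplace_neg_half :
    Tendsto (fun x => struveLaplace (-1 / 2) x + Real.log x) (𝓝[>] 0)
      (𝓝 (Real.log 2 - Real.eulerMascheroniConstant)) := by
  rw [← integral_log_two_mul_mul_exp_neg]
  refine tendsto_integral_log_add_sqrt_mul_exp_neg.congr' ?_
  filter_upwards [self_mem_nhdsWithin] with x hx
  exact (struveLaplace_neg_half_add_log hx).symm

/-! ### Laplace representation of `𝓚_m` -/

lemma poch_zero (a : ℝ) : poch a 0 = 1 := by simp [poch]

lemma poch_succ (a : ℝ) (m : ℕ) : poch a (m + 1) = poch a m * (a + m) := by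
  rw [poch, poch, ascPochhammer_succ_eval]

lemma poch_half_mul_sqrt_pi (r : ℕ) : poch (1 / 2) r * √Real.pi = Real.Gamma (r + 1 / 2) := by
  induction r with
  | zero => rw [poch_zero, Nat.cast_zero, zero_add, Real.Gamma_one_half_eq, one_mul]
  | succ r ih =>
    rw [poch_succ, Nat.cast_succ, add_right_comm, Real.Gamma_add_one (by positivity), ← ih]
    ring

lemma factorial_two_mul_add_one_mul_sqrt_pi (k : ℕ) :
    ((2 * k + 1).factorial : ℝ) * √Real.pi =
      2 ^ (2 * k + 1) * k.factorial * Real.Gamma (k + 3 / 2) := by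
  have h := Real.Gamma_mul_Gamma_add_half (k + 1)
  rw [Real.Gamma_nat_eq_factorial, show (k : ℝ) + 1 + 1 / 2 = k + 3 / 2 by ring,
    show 2 * ((k : ℝ) + 1) = ((2 * k + 1 : ℕ) : ℝ) + 1 by push_cast; ring,
    Real.Gamma_nat_eq_factorial, show 1 - (((2 * k + 1 : ℕ) : ℝ) + 1) = -(2 * k + 1 : ℕ) by ring,
    Real.rpow_neg zero_le_two, Real.rpow_natCast] at h
  rw [mul_assoc, h]
  field_simp

lemma Gamma_eq_two_pow_mul_poch_half (m : ℕ) :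
    Real.Gamma (2 * (m + 1 / 2) + 1) =
      2 ^ (2 * m + 1) * poch (1 / 2) (m + 1) * m.factorial := by
  have hπ : √Real.pi ≠ 0 := (Real.sqrt_pos.2 Real.pi_pos).ne'
  have hpoch := poch_half_mul_sqrt_pi (m + 1)
  have hfact := factorial_two_mul_add_one_mul_sqrt_pi m
  rw [show ((m + 1 : ℕ) : ℝ) + 1 / 2 = m + 3 / 2 by push_cast; ring] at hpoch
  rw [show 2 * ((m : ℝ) + 1 / 2) + 1 = ((2 * m + 1 : ℕ) : ℝ) + 1 by push_cast; ring,
    Real.Gamma_nat_eq_factorial]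
  refine mul_right_cancel₀ hπ ?_
  rw [hfact, ← hpoch]
  ring

lemma le_of_hasDerivAt_nonpos_of_tendsto {f f' : ℝ → ℝ} {l x : ℝ}
    (hf : ∀ y, 0 < y → HasDerivAt f (f' y) y) (hf' : ∀ y, 0 < y → f' y ≤ 0)
    (hl : Tendsto f (𝓝[>] 0) (𝓝 l)) (hx : 0 < x) : f x ≤ l := by
  have hanti : AntitoneOn f (Ioi 0) := by
    refine antitoneOn_of_hasDerivWithinAt_nonpos (f' := f') (convex_Ioi 0)
      (fun y hy => (hf y hy).continuousAt.continuousWithinAt) ?_ ?_ <;> rw [interior_Ioi]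
    · exact fun y hy => (hf y hy).hasDerivWithinAt
    · exact hf'
  refine ge_of_tendsto hl ?_
  filter_upwards [Ioo_mem_nhdsGT hx] with y hy
  exact hanti hy.1 hx hy.2.le

lemma eq_of_hasDerivAt_of_tendsto {f g f' : ℝ → ℝ} {l x : ℝ}
    (hf : ∀ y, 0 < y → HasDerivAt f (f' y) y) (hg : ∀ y, 0 < y → HasDerivAt g (f' y) y)
    (hfl : Tendsto f (𝓝[>] 0) (𝓝 l)) (hgl : Tendsto g (𝓝[>] 0) (𝓝 l)) (hx : 0 < x) :
    f x = g x := by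
  have hle {f g : ℝ → ℝ} (hf : ∀ y, 0 < y → HasDerivAt f (f' y) y)
      (hg : ∀ y, 0 < y → HasDerivAt g (f' y) y)
      (hfl : Tendsto f (𝓝[>] 0) (𝓝 l)) (hgl : Tendsto g (𝓝[>] 0) (𝓝 l)) : f x ≤ g x := by
    have h := le_of_hasDerivAt_nonpos_of_tendsto (fun y hy => (hf y hy).sub (hg y hy))
      (fun y _ => (sub_self _).le) (hfl.sub hgl) hx
    rwa [sub_self, Pi.sub_apply, sub_nonpos] at h
  exact le_antisymm (hle hf hg hfl hgl) (hle hg hf hgl hfl)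

lemma eq_zero_of_bessel_system {f g : ℝ → ℝ} {x : ℝ}
    (hf : ∀ y, 0 < y → HasDerivAt f (-(g y / y)) y) (hg : ∀ y, 0 < y → HasDerivAt g (y * f y) y)
    (hf₀ : Tendsto f (𝓝[>] 0) (𝓝 0)) (hg₀ : Tendsto g (𝓝[>] 0) (𝓝 0)) (hx : 0 < x) :
    f x = 0 := by
  have hid : Tendsto (fun y : ℝ => y) (𝓝[>] 0) (𝓝 0) := tendsto_id.mono_left nhdsWithin_le_nhds
  have hquot : Tendsto (fun y => g y / y) (𝓝[>] 0) (𝓝 0) := by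
    refine HasDerivAt.lhopital_zero_nhdsGT (f' := fun y => y * f y) (g' := fun _ => 1)
      ?_ (.of_forall hasDerivAt_id') (.of_forall fun _ => one_ne_zero) hg₀ hid ?_
    · filter_upwards [self_mem_nhdsWithin] with y hy using hg y hy
    · simpa using hid.mul hf₀
  have henergy (y : ℝ) (hy : 0 < y) : HasDerivAt (fun y => f y ^ 2 + (g y / y) ^ 2)
      (-2 * (g y ^ 2 / y ^ 3)) y := by
    refine (((hf y hy).pow 2).add
      (((hg y hy).div (hasDerivAt_id' y) hy.ne').pow 2)).congr_deriv ?_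
    simp only [Pi.div_apply]
    push_cast
    field_simp
    ring
  have henergy₀ : Tendsto (fun y => f y ^ 2 + (g y / y) ^ 2) (𝓝[>] 0) (𝓝 0) := by
    simpa using (hf₀.pow 2).add (hquot.pow 2)
  have hle := le_of_hasDerivAt_nonpos_of_tendsto henergy
    (fun y hy => mul_nonpos_of_nonpos_of_nonneg (by norm_num) (by positivity)) henergy₀ hx
  have hsq : f x ^ 2 ≤ 0 := by linarith [sq_nonneg (g x / x)]
  exact pow_eq_zero_iff two_ne_zero |>.1 (hsq.antisymm (sq_nonneg _))

lemma struveLaplace_neg_half_eq_scaledK {x : ℝ} (hx : 0 < x) :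
    2 / Real.pi * struveLaplace (-1 / 2) x = scaledK 0 x := by
  refine sub_eq_zero.1 <| eq_zero_of_bessel_system
    (f := fun y => 2 / Real.pi * struveLaplace (-1 / 2) y - scaledK 0 y)
    (g := fun y => 2 / Real.pi * struveLaplace (1 / 2) y - scaledK 1 y)
    (fun y hy => ?_) (fun y hy => ?_) ?_ ?_ hx
  · refine (((hasDerivAt_struveLaplace (-1 / 2) hy).const_mul (2 / Real.pi)).sub
      (hasDerivAt_scaledK_zero hy)).congr_deriv ?_
    have h : struveLaplace (1 / 2) y = y ^ 2 * struveLaplace (-1 / 2 - 1) y + y := by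
      rw [sq_mul_struveLaplace_neg_three_halves hy, sub_add_cancel]
    rw [h]
    field_simp
    ring
  · refine (((hasDerivAt_struveLaplace (1 / 2) hy).const_mul (2 / Real.pi)).sub
      (hasDerivAt_scaledK_succ 0 hy)).congr_deriv ?_
    rw [show (1 / 2 - 1 : ℝ) = -1 / 2 by norm_num]
    ring
  · have h := (tendsto_struveLaplace_neg_half.const_mul (2 / Real.pi)).sub tendsto_scaledK_zero
    rw [sub_self] at h
    exact h.congr fun y => by ring
  · have h := ((tendsto_struveLaplace_of_pos one_half_pos).const_mul (2 / Real.pi)).sub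
      (tendsto_scaledK_succ 0)
    have hlim : 2 / Real.pi * Real.Gamma (2 * (1 / 2) + 1) =
        2 ^ (0 + 1) * ((Nat.factorial 0 : ℝ) / Real.pi) := by
      norm_num [Real.Gamma_two, div_eq_mul_inv]
    rwa [hlim, sub_self] at h

lemma struveLaplace_eq_scaledK (m : ℕ) {x : ℝ} (hx : 0 < x) :
    2 / Real.pi * struveLaplace (m - 1 / 2) x = 2 ^ m * poch (1 / 2) m * scaledK m x := by
  induction m generalizing x with
  | zero =>
    rw [poch_zero, Nat.cast_zero, show (0 - 1 / 2 : ℝ) = -1 / 2 by norm_num,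
      struveLaplace_neg_half_eq_scaledK hx]
    ring
  | succ m ih =>
    rw [show ((m + 1 : ℕ) : ℝ) - 1 / 2 = m + 1 / 2 by push_cast; ring]
    refine eq_of_hasDerivAt_of_tendsto
      (f := fun y => 2 / Real.pi * struveLaplace (m + 1 / 2) y)
      (g := fun y => 2 ^ (m + 1) * poch (1 / 2) (m + 1) * scaledK (m + 1) y)
      (fun y hy => (hasDerivAt_struveLaplace (m + 1 / 2) hy).const_mul _) (fun y hy => ?_)
      ((tendsto_struveLaplace_of_pos (p := m + 1 / 2) (by positivity)).const_mul _) ?_ hx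
    · refine ((hasDerivAt_scaledK_succ m hy).const_mul _).congr_deriv ?_
      rw [show (m : ℝ) + 1 / 2 - 1 = m - 1 / 2 by ring, poch_succ]
      linear_combination (-(2 * m + 1) * y) * ih hy
    · have h := (tendsto_scaledK_succ m).const_mul (2 ^ (m + 1) * poch (1 / 2) (m + 1))
      convert h using 2
      rw [Gamma_eq_two_pow_mul_poch_half]
      ring

/-! ### The coefficients `C_m` -/

lemma integrableOn_pow_mul_exp_neg_mul (n : ℕ) {x : ℝ} (hx : 0 < x) :
    IntegrableOn (fun ξ : ℝ => ξ ^ n * Real.exp (-x * ξ)) (Ioi 0) := by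
  have h := integrableOn_rpow_mul_exp_neg_mul_rpow (s := n) (p := 1) (b := x)
    (by linarith [n.cast_nonneg (α := ℝ)]) one_pos hx
  refine h.congr_fun (fun ξ _ => ?_) measurableSet_Ioi
  simp only [Real.rpow_natCast, Real.rpow_one]

lemma one_le_sqrt_one_add_sq (ξ : ℝ) : 1 ≤ √(1 + ξ ^ 2) :=
  Real.le_sqrt_of_sq_le (by nlinarith [sq_nonneg ξ])

lemma continuous_coeffIntegrand (m : ℕ) (x : ℝ) : Continuous (coeffIntegrand m x) :=
  Continuous.div (by fun_prop) (by fun_prop) fun ξ =>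
    (one_pos.trans_le (one_le_sqrt_one_add_sq ξ)).ne'

lemma integrableOn_coeffIntegrand (m : ℕ) {x : ℝ} (hx : 0 < x) :
    IntegrableOn (coeffIntegrand m x) (Ioi 0) := by
  refine Integrable.mono' (integrableOn_pow_mul_exp_neg_mul (2 * m) hx)
    (continuous_coeffIntegrand m x).aestronglyMeasurable
    (ae_restrict_of_forall_mem measurableSet_Ioi fun ξ (hξ : 0 < ξ) => ?_)
  rw [coeffIntegrand, Real.norm_of_nonneg (by positivity)]
  exact div_le_self (by positivity) (one_le_sqrt_one_add_sq ξ)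

lemma struveLaplace_eq_integral_comp_mul (p : ℝ) {x : ℝ} (hx : 0 < x) :
    struveLaplace p x =
      x * ∫ ξ in Ioi (0 : ℝ), (x ^ 2 + (x * ξ) ^ 2) ^ p * Real.exp (-(x * ξ)) := by
  have h := integral_comp_mul_left_Ioi'
    (fun s : ℝ => (x ^ 2 + s ^ 2) ^ p * Real.exp (-s)) 0 hx
  rw [mul_zero, smul_eq_mul] at h
  rw [struveLaplace, ← h]

lemma mul_sq_add_sq_rpow_mul_exp_neg_eq_sum (m : ℕ) {x : ℝ} (hx : 0 < x) (ξ : ℝ) :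
    x * ((x ^ 2 + (x * ξ) ^ 2) ^ ((m : ℝ) - 1 / 2) * Real.exp (-(x * ξ))) =
      ∑ r ∈ Finset.range (m + 1), m.choose r * x ^ (2 * m) * coeffIntegrand r x ξ := by
  have hpos : (0 : ℝ) < 1 + ξ ^ 2 := by positivity
  have hrpow : (x ^ 2 + (x * ξ) ^ 2) ^ ((m : ℝ) - 1 / 2) =
      x ^ (2 * m) / x * ((ξ ^ 2 + 1) ^ m / √(1 + ξ ^ 2)) := by
    rw [show x ^ 2 + (x * ξ) ^ 2 = x ^ 2 * (1 + ξ ^ 2) by ring,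
      Real.mul_rpow (by positivity) hpos.le, Real.rpow_sub (by positivity), Real.rpow_sub hpos,
      Real.rpow_natCast, Real.rpow_natCast, ← Real.sqrt_eq_rpow, ← Real.sqrt_eq_rpow,
      Real.sqrt_sq hx.le, ← pow_mul, add_comm (ξ ^ 2)]
  rw [hrpow, add_pow, Finset.sum_div, Finset.mul_sum, Finset.sum_mul, Finset.mul_sum]
  refine Finset.sum_congr rfl fun r _ => ?_
  rw [coeffIntegrand, one_pow, mul_one, ← pow_mul, neg_mul]
  field_simp

lemma sum_choose_mul_coeffC (m : ℕ) {x : ℝ} (hx : 0 < x) :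
    ∑ r ∈ Finset.range (m + 1), (m.choose r : ℝ) * x ^ (2 * (m - r)) * coeffC r x =
      2 / Real.pi * struveLaplace (m - 1 / 2) x := by
  rw [struveLaplace_eq_integral_comp_mul _ hx, ← integral_const_mul]
  simp only [mul_sq_add_sq_rpow_mul_exp_neg_eq_sum m hx]
  rw [integral_finsetSum _ fun r _ => (integrableOn_coeffIntegrand r hx).const_mul _,
    Finset.mul_sum]
  refine Finset.sum_congr rfl fun r hr => ?_
  have hrm : r ≤ m := Nat.lt_succ_iff.1 (Finset.mem_range.1 hr)
  rw [coeffC, integral_const_mul, show 2 * m = 2 * (m - r) + 2 * r by lia, pow_add]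
  ring

lemma coeffC_recurrence (m : ℕ) {x : ℝ} (hx : 0 < x) :
    coeffC m x = 2 ^ m * poch (1 / 2) m * scaledK m x -
      ∑ r ∈ Finset.range m, (m.choose r : ℝ) * x ^ (2 * (m - r)) * coeffC r x := by
  rw [← struveLaplace_eq_scaledK m hx, ← sum_choose_mul_coeffC m hx, Finset.sum_range_succ]
  simp

/-! ### Poisson integrals of the scaled Struve functions -/

lemma hasSum_intervalIntegral_of_abs_le {f : ℕ → ℝ → ℝ} {g : ℝ → ℝ} {C : ℕ → ℝ} (a b : ℝ)
    (hf : ∀ k, Continuous (f k)) (hC : Summable C) (hfC : ∀ k t, |f k t| ≤ C k)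
    (hg : ∀ t, HasSum (fun k => f k t) (g t)) :
    HasSum (fun k => ∫ t in a..b, f k t) (∫ t in a..b, g t) :=
  intervalIntegral.hasSum_integral_of_dominated_convergence (fun k _ => C k)
    (fun k => (hf k).aestronglyMeasurable) (fun k => ae_of_all _ fun t _ => hfC k t)
    (ae_of_all _ fun _ _ => hC) intervalIntegrable_const (ae_of_all _ fun t _ => hg t)

lemma integral_pow_mul_one_sub_sq_pow (r k : ℕ) :
    ∫ s in (0 : ℝ)..1, s ^ (2 * r) * (1 - s ^ 2) ^ k =
      Real.Gamma (r + 1 / 2) * k.factorial / (2 * Real.Gamma (k + r + 3 / 2)) := by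
  induction k generalizing r with
  | zero =>
    have hG : Real.Gamma ((r : ℝ) + 3 / 2) = (r + 1 / 2) * Real.Gamma (r + 1 / 2) := by
      rw [← Real.Gamma_add_one (by positivity)]
      ring_nf
    have : Real.Gamma ((r : ℝ) + 1 / 2) ≠ 0 := (Real.Gamma_pos_of_pos (by positivity)).ne'
    simp only [pow_zero, mul_one, integral_pow, Nat.cast_zero, zero_add, hG, Nat.factorial_zero,
      Nat.cast_one]
    push_cast
    rw [one_pow, zero_pow (2 * r).succ_ne_zero]
    field_simp
    ring
  | succ k ih =>
    have hG₁ : Real.Gamma ((r : ℝ) + 1 + 1 / 2) = (r + 1 / 2) * Real.Gamma (r + 1 / 2) := by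
      rw [← Real.Gamma_add_one (by positivity)]
      ring_nf
    have hG₂ : Real.Gamma ((k : ℝ) + (r + 1) + 3 / 2) =
        (k + r + 3 / 2) * Real.Gamma (k + r + 3 / 2) := by
      rw [← Real.Gamma_add_one (by positivity)]
      ring_nf
    have : Real.Gamma ((k : ℝ) + r + 3 / 2) ≠ 0 := (Real.Gamma_pos_of_pos (by positivity)).ne'
    have hsplit (s : ℝ) : s ^ (2 * r) * (1 - s ^ 2) ^ (k + 1) =
        s ^ (2 * r) * (1 - s ^ 2) ^ k - s ^ (2 * (r + 1)) * (1 - s ^ 2) ^ k := by ring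
    simp_rw [hsplit]
    rw [intervalIntegral.integral_sub (Continuous.intervalIntegrable (by fun_prop) _ _)
      (Continuous.intervalIntegrable (by fun_prop) _ _), ih r, ih (r + 1)]
    push_cast
    rw [hG₁, show (k : ℝ) + 1 + r + 3 / 2 = k + (r + 1) + 3 / 2 by ring, hG₂, Nat.factorial_succ]
    push_cast
    field_simp
    ring

lemma integral_sin_pow_even_mul_cos_pow_odd (r k : ℕ) :
    ∫ b in (0 : ℝ)..(Real.pi / 2), Real.sin b ^ (2 * r) * Real.cos b ^ (2 * k + 1) =
      Real.pi / 2 * poch (1 / 2) r * (2 * k + 1).factorial /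
        (2 ^ (2 * k + 1) * Real.Gamma (k + 3 / 2) * Real.Gamma (k + r + 3 / 2)) := by
  have hπ : √Real.pi * √Real.pi = Real.pi := Real.mul_self_sqrt Real.pi_pos.le
  have : Real.Gamma ((k : ℝ) + 3 / 2) ≠ 0 := (Real.Gamma_pos_of_pos (by positivity)).ne'
  have : Real.Gamma ((k : ℝ) + r + 3 / 2) ≠ 0 := (Real.Gamma_pos_of_pos (by positivity)).ne'
  rw [integral_sin_pow_mul_cos_pow_odd, Real.sin_zero, Real.sin_pi_div_two,
    integral_pow_mul_one_sub_sq_pow, ← poch_half_mul_sqrt_pi,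
    div_eq_div_iff (by positivity) (by positivity)]
  linear_combination (-√Real.pi * poch (1 / 2) r * Real.Gamma (k + r + 3 / 2)) *
    factorial_two_mul_add_one_mul_sqrt_pi k + (poch (1 / 2) r * Real.Gamma (k + r + 3 / 2) *
    (2 * k + 1).factorial) * hπ

lemma poch_half_mul_scaledStruve (r : ℕ) {x : ℝ} (hx : 0 < x) :
    poch (1 / 2) r * scaledStruve r x =
      2 / Real.pi * ∫ b in (0 : ℝ)..(Real.pi / 2),
        Real.sin b ^ (2 * r) * Real.sin (x * Real.cos b) := by
  have h : HasSum (fun k : ℕ => ∫ b in (0 : ℝ)..(Real.pi / 2), Real.sin b ^ (2 * r) *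
      ((-1) ^ k * (x * Real.cos b) ^ (2 * k + 1) / (2 * k + 1).factorial))
      (∫ b in (0 : ℝ)..(Real.pi / 2), Real.sin b ^ (2 * r) * Real.sin (x * Real.cos b)) := by
    refine hasSum_intervalIntegral_of_abs_le _ _ (fun k => by fun_prop)
      (Real.hasSum_sinh x).summable (fun k b => ?_) fun b => (Real.hasSum_sin _).mul_left _
    have hsin : |Real.sin b| ^ (2 * r) ≤ 1 := pow_le_one₀ (abs_nonneg _) (Real.abs_sin_le_one b)
    have hcos : x * |Real.cos b| ≤ x := mul_le_of_le_one_right hx.le (Real.abs_cos_le_one b)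
    rw [abs_mul, abs_div, abs_mul, abs_pow, abs_neg_one_pow, one_mul, abs_pow, abs_mul,
      abs_of_pos hx, Nat.abs_cast]
    calc |Real.sin b| ^ (2 * r) * ((x * |Real.cos b|) ^ (2 * k + 1) / (2 * k + 1).factorial)
        ≤ 1 * (x ^ (2 * k + 1) / (2 * k + 1).factorial) := by gcongr
      _ = x ^ (2 * k + 1) / (2 * k + 1).factorial := one_mul _
  rw [← h.tsum_eq, scaledStruve_natCast r hx, halfPowSeries, ← tsum_mul_left, ← tsum_mul_left]
  refine tsum_congr fun k => ?_
  have hpull (b : ℝ) : Real.sin b ^ (2 * r) *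
      ((-1) ^ k * (x * Real.cos b) ^ (2 * k + 1) / ((2 * k + 1).factorial : ℝ)) =
      (-1) ^ k * x ^ (2 * k + 1) / ((2 * k + 1).factorial : ℝ) *
        (Real.sin b ^ (2 * r) * Real.cos b ^ (2 * k + 1)) := by ring
  simp_rw [hpull]
  rw [intervalIntegral.integral_const_mul, integral_sin_pow_even_mul_cos_pow_odd, struveCoeff,
    div_pow]
  field_simp

lemma hasSum_struveTerm {x : ℝ} (hx : 0 < x) (ρ : ℝ) :
    HasSum (struveTerm x ρ) (2 / Real.pi * ∫ b in (0 : ℝ)..(Real.pi / 2),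
      Real.exp (ρ * Real.sin b ^ 2) * Real.sin (x * Real.cos b)) := by
  have hexp (z : ℝ) : HasSum (fun r : ℕ => z ^ r / r.factorial) (Real.exp z) := by
    rw [Real.exp_eq_exp_ℝ]
    exact NormedSpace.expSeries_div_hasSum_exp z
  have h : HasSum (fun r : ℕ => ∫ b in (0 : ℝ)..(Real.pi / 2),
      (ρ * Real.sin b ^ 2) ^ r / r.factorial * Real.sin (x * Real.cos b))
      (∫ b in (0 : ℝ)..(Real.pi / 2),
        Real.exp (ρ * Real.sin b ^ 2) * Real.sin (x * Real.cos b)) := by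
    refine hasSum_intervalIntegral_of_abs_le _ _ (fun r => by fun_prop)
      (Real.summable_pow_div_factorial |ρ|) (fun r b => ?_)
      fun b => (hexp _).mul_right _
    have hsin : |ρ| * |Real.sin b| ^ 2 ≤ |ρ| := mul_le_of_le_one_right (abs_nonneg _)
      (pow_le_one₀ (abs_nonneg _) (Real.abs_sin_le_one b))
    rw [abs_mul, abs_div, abs_pow, abs_mul, abs_pow, Nat.abs_cast]
    calc (|ρ| * |Real.sin b| ^ 2) ^ r / r.factorial * |Real.sin (x * Real.cos b)|
        ≤ |ρ| ^ r / r.factorial * 1 := by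
          gcongr
          exact Real.abs_sin_le_one _
      _ = |ρ| ^ r / r.factorial := mul_one _
  refine (h.mul_left (2 / Real.pi)).congr_fun fun r => ?_
  have hpull (b : ℝ) :
      (ρ * Real.sin b ^ 2) ^ r / (r.factorial : ℝ) * Real.sin (x * Real.cos b) =
        ρ ^ r / r.factorial * (Real.sin b ^ (2 * r) * Real.sin (x * Real.cos b)) := by ring
  simp_rw [hpull]
  rw [intervalIntegral.integral_const_mul, struveTerm]
  linear_combination (ρ ^ r / r.factorial) * poch_half_mul_scaledStruve r hx

/-! ### Rectangular contour through the saddle point -/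

/-- The function `exp(-ρ cosh² u + i x cosh u)`, whose real part on the real axis is
`exp(-ρ/2)` times the integrand of `F(x, ρ, 0)`. It is integrated along a rectangular contour. -/
def waveExp (x ρ : ℝ) (u : ℂ) : ℂ :=
  Complex.exp (-(ρ : ℂ) * Complex.cosh u ^ 2 + Complex.I * x * Complex.cosh u)

lemma differentiable_waveExp (x ρ : ℝ) : Differentiable ℂ (waveExp x ρ) := by
  unfold waveExp
  fun_prop

lemma waveExp_add_mul_I (x ρ a b : ℝ) : waveExp x ρ (a + b * Complex.I) =
    Complex.exp ⟨-ρ * (Real.cosh a ^ 2 * Real.cos b ^ 2 - Real.sinh a ^ 2 * Real.sin b ^ 2) -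
        x * Real.sinh a * Real.sin b,
      x * Real.cosh a * Real.cos b -
        2 * ρ * Real.cosh a * Real.sinh a * Real.cos b * Real.sin b⟩ := by
  rw [waveExp, Complex.cosh_add, Complex.cosh_mul_I, Complex.sinh_mul_I,
    Complex.mk_eq_add_mul_I]
  push_cast
  congr 1
  linear_combination (-(ρ : ℂ) * (Complex.sinh a * Complex.sin b) ^ 2 +
    x * Complex.sinh a * Complex.sin b) * Complex.I_sq

lemma norm_waveExp (x ρ a b : ℝ) : ‖waveExp x ρ (a + b * Complex.I)‖ =
    Real.exp (-ρ * (Real.cosh a ^ 2 * Real.cos b ^ 2 - Real.sinh a ^ 2 * Real.sin b ^ 2) -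
      x * Real.sinh a * Real.sin b) := by
  rw [waveExp_add_mul_I, Complex.norm_exp]

lemma norm_waveExp_ofReal (x ρ t : ℝ) :
    ‖waveExp x ρ t‖ = Real.exp (-ρ * Real.cosh t ^ 2) := by
  simpa using norm_waveExp x ρ t 0

lemma waveExp_ofReal_re (x ρ t : ℝ) :
    (waveExp x ρ t).re = Real.exp (-ρ * Real.cosh t ^ 2) * Real.cos (x * Real.cosh t) := by
  have h := congrArg Complex.re (waveExp_add_mul_I x ρ t 0)
  rw [Complex.exp_re] at h
  simpa using h

lemma waveExp_mul_I_im (x ρ b : ℝ) : (waveExp x ρ (b * Complex.I)).im =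
    Real.exp (-ρ * Real.cos b ^ 2) * Real.sin (x * Real.cos b) := by
  have h := congrArg Complex.im (waveExp_add_mul_I x ρ 0 b)
  rw [Complex.exp_im] at h
  simpa using h

lemma waveExp_add_pi_div_two_mul_I (x ρ t : ℝ) :
    waveExp x ρ (t + ((Real.pi / 2 : ℝ) : ℂ) * Complex.I) =
      ((Real.exp (ρ * Real.sinh t ^ 2 - x * Real.sinh t) : ℝ) : ℂ) := by
  rw [waveExp_add_mul_I, Real.cos_pi_div_two, Real.sin_pi_div_two, Complex.ofReal_exp]
  congr 1
  apply Complex.ext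
  · rw [Complex.ofReal_re]
    ring
  · rw [Complex.ofReal_im]
    ring

lemma re_integral_waveExp (x ρ a : ℝ) :
    (∫ t in (0 : ℝ)..a, waveExp x ρ t).re =
      (∫ t in (0 : ℝ)..a, Real.exp (ρ * Real.sinh t ^ 2 - x * Real.sinh t)) +
      (∫ b in (0 : ℝ)..(Real.pi / 2), waveExp x ρ (a + b * Complex.I)).im -
      ∫ b in (0 : ℝ)..(Real.pi / 2),
        Real.exp (-ρ * Real.cos b ^ 2) * Real.sin (x * Real.cos b) := by
  have hc : Continuous (waveExp x ρ) := (differentiable_waveExp x ρ).continuous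
  have hside : (∫ b in (0 : ℝ)..(Real.pi / 2), waveExp x ρ (b * Complex.I)).im =
      ∫ b in (0 : ℝ)..(Real.pi / 2), Real.exp (-ρ * Real.cos b ^ 2) *
        Real.sin (x * Real.cos b) := by
    simp_rw [← waveExp_mul_I_im]
    exact (Complex.imCLM.intervalIntegral_comp_comm
      (Continuous.intervalIntegrable (by fun_prop) _ _)).symm
  have hrect := congrArg Complex.re (Complex.integral_boundary_rect_eq_zero_of_differentiableOn
    (waveExp x ρ) 0 (a + ((Real.pi / 2 : ℝ) : ℂ) * Complex.I)
    (differentiable_waveExp x ρ).differentiableOn)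
  simp only [Complex.zero_re, Complex.zero_im, Complex.add_re, Complex.add_im, Complex.ofReal_re,
    Complex.ofReal_im, Complex.re_ofReal_mul, Complex.im_ofReal_mul, Complex.I_re, Complex.I_im,
    mul_zero, mul_one, add_zero, zero_add, Complex.ofReal_zero, zero_mul,
    waveExp_add_pi_div_two_mul_I, smul_eq_mul, intervalIntegral.integral_ofReal, Complex.sub_re,
    Complex.I_mul_re, hside] at hrect
  linarith

lemma bigM_eq_mul_sq {x ρ : ℝ} (hρ : 0 < ρ) : bigM x ρ = ρ * (x / (2 * ρ)) ^ 2 := by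
  rw [bigM]
  field_simp
  ring

lemma norm_waveExp_saddle_le {x ρ b : ℝ} (hρ : 0 < ρ) (hb₀ : 0 ≤ b) (hb : b ≤ Real.pi) :
    ‖waveExp x ρ (Real.arsinh (x / (2 * ρ)) + b * Complex.I)‖ ≤ Real.exp (-bigM x ρ) := by
  have hx : x = 2 * ρ * (x / (2 * ρ)) := by field_simp
  rw [norm_waveExp, Real.exp_le_exp, Real.cosh_sq, Real.sinh_arsinh, Real.cos_sq',
    bigM_eq_mul_sq hρ]
  generalize x / (2 * ρ) = y at hx ⊢
  subst hx
  have hs₀ : 0 ≤ Real.sin b := Real.sin_nonneg_of_nonneg_of_le_pi hb₀ hb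
  have hs₁ : 0 ≤ 1 - Real.sin b := sub_nonneg.2 (Real.sin_le_one b)
  have hcos : 0 ≤ ρ * (1 + Real.sin b) * (1 - Real.sin b) := by positivity
  have hgain : 0 ≤ 2 * ρ * y ^ 2 * Real.sin b * (1 - Real.sin b) := by positivity
  linarith

lemma abs_im_integral_waveExp_saddle_le (x : ℝ) {ρ : ℝ} (hρ : 0 < ρ) :
    |(∫ b in (0 : ℝ)..(Real.pi / 2),
      waveExp x ρ (Real.arsinh (x / (2 * ρ)) + b * Complex.I)).im| ≤
      Real.pi / 2 * Real.exp (-bigM x ρ) := by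
  have hπ : 0 ≤ Real.pi / 2 := by positivity
  refine (Complex.abs_im_le_norm _).trans ?_
  refine (intervalIntegral.norm_integral_le_of_norm_le_const (C := Real.exp (-bigM x ρ))
    fun b hb => ?_).trans_eq ?_
  · rw [uIoc_of_le hπ] at hb
    exact norm_waveExp_saddle_le hρ hb.1.le (hb.2.trans (half_le_self Real.pi_pos.le))
  · rw [sub_zero, abs_of_nonneg hπ, mul_comm]

lemma integrable_waveExp (x : ℝ) {ρ : ℝ} (hρ : 0 < ρ) :
    Integrable fun t : ℝ => waveExp x ρ t := by
  have hc : Continuous (waveExp x ρ) := (differentiable_waveExp x ρ).continuous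
  refine (integrable_exp_neg_mul_sq hρ).mono'
    (Continuous.aestronglyMeasurable (by fun_prop)) (ae_of_all _ fun t => ?_)
  have hcosh : t ^ 2 ≤ Real.cosh t ^ 2 := by
    rw [← sq_abs, ← Real.cosh_abs]
    gcongr
    exact (Real.self_le_sinh_iff.2 (abs_nonneg t)).trans (Real.sinh_lt_cosh _).le
  rw [norm_waveExp_ofReal, Real.exp_le_exp, neg_mul, neg_mul, neg_le_neg_iff]
  gcongr

section Tail

variable {ρ a : ℝ}

lemma hasDerivAt_exp_neg_mul_sinh_sq (hρ : 0 < ρ) (t : ℝ) :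
    HasDerivAt (fun t => -((2 * ρ)⁻¹ * Real.exp (-ρ * Real.sinh t ^ 2)))
      (Real.sinh t * Real.cosh t * Real.exp (-ρ * Real.sinh t ^ 2)) t := by
  refine (((((Real.hasDerivAt_sinh t).pow 2).const_mul (-ρ)).exp).const_mul _).neg.congr_deriv ?_
  simp only [Pi.pow_apply]
  push_cast
  field_simp

lemma tendsto_exp_neg_mul_sinh_sq (hρ : 0 < ρ) :
    Tendsto (fun t => -((2 * ρ)⁻¹ * Real.exp (-ρ * Real.sinh t ^ 2))) atTop (𝓝 0) := by
  have hsinh : Tendsto Real.sinh atTop atTop :=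
    tendsto_atTop_mono' _ ((eventually_ge_atTop 0).mono fun _ => Real.self_le_sinh_iff.2) tendsto_id
  have hsq : Tendsto (fun t => -ρ * Real.sinh t ^ 2) atTop atBot :=
    ((tendsto_pow_atTop two_ne_zero).comp hsinh).const_mul_atTop_of_neg
      (neg_lt_zero.2 hρ)
  simpa only [mul_zero, neg_zero, Function.comp] using
    ((Real.tendsto_exp_atBot.comp hsq).const_mul (2 * ρ)⁻¹).neg

lemma sinh_mul_cosh_mul_exp_nonneg (ha : 0 ≤ a) :
    ∀ t ∈ Ioi a, 0 ≤ Real.sinh t * Real.cosh t * Real.exp (-ρ * Real.sinh t ^ 2) := by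
  intro t ht
  have hsinh : 0 ≤ Real.sinh t := Real.sinh_nonneg_iff.2 (ha.trans (mem_Ioi.1 ht).le)
  have : 0 < Real.cosh t := Real.cosh_pos t
  positivity

lemma integrableOn_sinh_mul_cosh_mul_exp (hρ : 0 < ρ) (ha : 0 ≤ a) :
    IntegrableOn (fun t => Real.sinh t * Real.cosh t * Real.exp (-ρ * Real.sinh t ^ 2)) (Ioi a) :=
  integrableOn_Ioi_deriv_of_nonneg' (fun t _ => hasDerivAt_exp_neg_mul_sinh_sq hρ t)
    (sinh_mul_cosh_mul_exp_nonneg ha) (tendsto_exp_neg_mul_sinh_sq hρ)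

lemma integral_sinh_mul_cosh_mul_exp (hρ : 0 < ρ) (ha : 0 ≤ a) :
    ∫ t in Ioi a, Real.sinh t * Real.cosh t * Real.exp (-ρ * Real.sinh t ^ 2) =
      (2 * ρ)⁻¹ * Real.exp (-ρ * Real.sinh a ^ 2) := by
  rw [integral_Ioi_of_hasDerivAt_of_nonneg' (fun t _ => hasDerivAt_exp_neg_mul_sinh_sq hρ t)
    (sinh_mul_cosh_mul_exp_nonneg ha) (tendsto_exp_neg_mul_sinh_sq hρ), zero_sub, neg_neg]

lemma norm_integral_Ioi_waveExp_le (x : ℝ) (hρ : 0 < ρ) (ha : 0 < a) :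
    ‖∫ t in Ioi a, waveExp x ρ t‖ ≤
      (2 * (ρ * Real.sinh a ^ 2))⁻¹ * Real.exp (-(ρ * Real.sinh a ^ 2)) := by
  have hs : 0 < Real.sinh a := Real.sinh_pos_iff.2 ha
  calc ‖∫ t in Ioi a, waveExp x ρ t‖
      ≤ ∫ t in Ioi a, (Real.sinh a ^ 2)⁻¹ *
          (Real.sinh t * Real.cosh t * Real.exp (-ρ * Real.sinh t ^ 2)) := by
        refine norm_integral_le_of_norm_le
          ((integrableOn_sinh_mul_cosh_mul_exp hρ ha.le).const_mul _)
          (ae_restrict_of_forall_mem measurableSet_Ioi fun t ht => ?_)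
        have hst : Real.sinh a ≤ Real.sinh t := Real.sinh_le_sinh.2 (mem_Ioi.1 ht).le
        have hcosh : Real.sinh t ≤ Real.cosh t := (Real.sinh_lt_cosh t).le
        have hone : 1 ≤ (Real.sinh a ^ 2)⁻¹ * (Real.sinh t * Real.cosh t) := by
          rw [← div_eq_inv_mul, one_le_div (by positivity), sq]
          exact mul_le_mul hst (hst.trans hcosh) hs.le (hs.le.trans hst)
        rw [norm_waveExp_ofReal, ← mul_assoc]
        calc Real.exp (-ρ * Real.cosh t ^ 2) ≤ 1 * Real.exp (-ρ * Real.sinh t ^ 2) := by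
              rw [one_mul, Real.exp_le_exp, Real.cosh_sq]
              linarith
          _ ≤ _ := by gcongr
    _ = (2 * (ρ * Real.sinh a ^ 2))⁻¹ * Real.exp (-(ρ * Real.sinh a ^ 2)) := by
        rw [integral_const_mul, integral_sinh_mul_cosh_mul_exp hρ ha.le, neg_mul]
        ring

end Tail

lemma abs_re_integral_Ioi_waveExp_saddle_le {x ρ : ℝ} (hx : 0 < x) (hρ : 0 < ρ) :
    |(∫ t in Ioi (Real.arsinh (x / (2 * ρ))), waveExp x ρ t).re| ≤
      1 / 2 * ((bigM x ρ)⁻¹ * Real.exp (-bigM x ρ)) := by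
  have ha : 0 < Real.arsinh (x / (2 * ρ)) := Real.arsinh_pos_iff.2 (by positivity)
  refine (Complex.abs_re_le_norm _).trans ((norm_integral_Ioi_waveExp_le x hρ ha).trans_eq ?_)
  rw [Real.sinh_arsinh, ← bigM_eq_mul_sq hρ]
  ring

lemma integrand_zero (x ρ u : ℝ) :
    integrand x ρ 0 u = ((Real.exp (ρ / 2) * (waveExp x ρ u).re : ℝ) : ℂ) := by
  have hcosh : -((ρ : ℂ) / 2) * Complex.cosh (2 * u - Complex.I * ((0 : ℝ) : ℂ)) =
      ((ρ / 2 + -ρ * Real.cosh u ^ 2 : ℝ) : ℂ) := by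
    rw [Complex.ofReal_zero, mul_zero, sub_zero, Complex.cosh_two_mul, Complex.sinh_sq]
    push_cast
    ring
  rw [integrand, hcosh, waveExp_ofReal_re, ← mul_assoc, ← Real.exp_add]
  push_cast
  rfl

lemma integrable_integrand_zero (x : ℝ) {ρ : ℝ} (hρ : 0 < ρ) : Integrable (integrand x ρ 0) := by
  have h := ((integrable_waveExp x hρ).re.const_mul (Real.exp (ρ / 2))).ofReal (𝕜 := ℂ)
  exact h.congr (ae_of_all _ fun u => (integrand_zero x ρ u).symm)

lemma F_zero_eq_re_integral (x : ℝ) {ρ : ℝ} (hρ : 0 < ρ) (a : ℝ) : F x ρ 0 =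
    ((2 * Real.exp (ρ / 2) * ((∫ t in (0 : ℝ)..a, waveExp x ρ t).re +
      (∫ t in Ioi a, waveExp x ρ t).re) : ℝ) : ℂ) := by
  have hi := integrable_waveExp x hρ
  have heven : ∫ t : ℝ, (waveExp x ρ t).re = 2 * ∫ t in Ioi (0 : ℝ), (waveExp x ρ t).re := by
    rw [← integral_comp_abs (f := fun t : ℝ => (waveExp x ρ t).re)]
    simp only [waveExp_ofReal_re, Real.cosh_abs]
  have hre : (∫ t in Ioi (0 : ℝ), waveExp x ρ t).re = ∫ t in Ioi (0 : ℝ), (waveExp x ρ t).re :=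
    (integral_re hi.integrableOn).symm
  rw [← Complex.add_re, intervalIntegral.integral_interval_add_Ioi hi.integrableOn hi.integrableOn,
    hre, mul_comm 2, mul_assoc, ← heven, ← integral_const_mul, ← integral_complex_ofReal, F]
  simp_rw [integrand_zero]

/-! ### The asymptotic series -/

lemma integral_exp_sinh_eq_integral_indicator (x ρ : ℝ) {y : ℝ} (hy : 0 ≤ y) :
    ∫ t in (0 : ℝ)..(Real.arsinh y), Real.exp (ρ * Real.sinh t ^ 2 - x * Real.sinh t) =
      ∫ ξ in Ioi (0 : ℝ), (Iic y).indicator (fun ξ => Real.exp (ρ * ξ ^ 2)) ξ *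
        coeffIntegrand 0 x ξ := by
  have hsubst := intervalIntegral.integral_comp_mul_deriv (a := 0) (b := y) (f := Real.arsinh)
    (f' := fun ξ => (√(1 + ξ ^ 2))⁻¹)
    (g := fun t => Real.exp (ρ * Real.sinh t ^ 2 - x * Real.sinh t))
    (fun ξ _ => Real.hasDerivAt_arsinh ξ)
    (Continuous.continuousOn (Continuous.inv₀ (by fun_prop) fun ξ =>
      (zero_lt_one.trans_le (one_le_sqrt_one_add_sq ξ)).ne')) (by fun_prop)
  rw [Real.arsinh_zero] at hsubst
  simp_rw [← indicator_mul_left]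
  rw [← hsubst, intervalIntegral.integral_of_le hy, setIntegral_indicator measurableSet_Iic,
    Ioi_inter_Iic]
  refine setIntegral_congr_fun measurableSet_Ioc fun ξ _ => ?_
  simp only [Function.comp, Real.sinh_arsinh, coeffIntegrand, mul_zero, pow_zero, one_mul,
    sub_eq_add_neg, Real.exp_add, neg_mul]
  ring

lemma integrableOn_indicator_mul_coeffIntegrand (x ρ y : ℝ) :
    IntegrableOn (fun ξ => (Iic y).indicator (fun ξ => Real.exp (ρ * ξ ^ 2)) ξ *
      coeffIntegrand 0 x ξ) (Ioi 0) := by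
  have hc : Continuous fun ξ => Real.exp (ρ * ξ ^ 2) * coeffIntegrand 0 x ξ :=
    Continuous.mul (by fun_prop) (continuous_coeffIntegrand 0 x)
  simp_rw [← indicator_mul_left]
  rw [IntegrableOn, integrable_indicator_iff measurableSet_Iic, IntegrableOn,
    Measure.restrict_restrict measurableSet_Iic, Iic_inter_Ioi]
  exact hc.integrableOn_Ioc

lemma sum_mul_coeffIntegrand_zero (x ρ ξ : ℝ) (n : ℕ) :
    (∑ k ∈ Finset.range n, (ρ * ξ ^ 2) ^ k / (k.factorial : ℝ)) * coeffIntegrand 0 x ξ =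
      ∑ k ∈ Finset.range n, ρ ^ k / (k.factorial : ℝ) * coeffIntegrand k x ξ := by
  rw [Finset.sum_mul]
  refine Finset.sum_congr rfl fun k _ => ?_
  rw [coeffIntegrand, coeffIntegrand, mul_pow, ← pow_mul]
  ring

lemma integrableOn_sum_mul_coeffIntegrand (ρ : ℝ) {x : ℝ} (hx : 0 < x) (n : ℕ) :
    IntegrableOn (fun ξ => (∑ k ∈ Finset.range n, (ρ * ξ ^ 2) ^ k / (k.factorial : ℝ)) *
      coeffIntegrand 0 x ξ) (Ioi 0) := by
  simp_rw [sum_mul_coeffIntegrand_zero]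
  exact integrable_finsetSum _ fun k _ => (integrableOn_coeffIntegrand k hx).const_mul _

lemma asympSum_eq_integral {x ρ : ℝ} (hx : 0 < x) (n : ℕ) :
    asympSum x ρ n = 2 / Real.pi * ∫ ξ in Ioi (0 : ℝ),
      (∑ k ∈ Finset.range n, (ρ * ξ ^ 2) ^ k / (k.factorial : ℝ)) * coeffIntegrand 0 x ξ := by
  simp_rw [sum_mul_coeffIntegrand_zero]
  rw [integral_finsetSum _ fun k _ => (integrableOn_coeffIntegrand k hx).const_mul _, asympSum,
    Finset.mul_sum]
  refine Finset.sum_congr rfl fun k _ => ?_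
  have hM : (bigM x ρ ^ k)⁻¹ = 2 ^ (2 * k) * ρ ^ k / x ^ (2 * k) := by
    rw [bigM, div_pow, inv_div, mul_pow, pow_mul, pow_mul]
    norm_num
  rw [integral_const_mul, coeffC, hM]
  field_simp

lemma abs_exp_sub_sum_le {z : ℝ} (hz : 0 ≤ z) (n : ℕ) :
    |Real.exp z - ∑ k ∈ Finset.range n, z ^ k / (k.factorial : ℝ)| ≤ z ^ n * Real.exp z := by
  have h := Complex.norm_exp_sub_sum_le_norm_mul_exp (z : ℂ) n
  rw [Complex.norm_of_nonneg hz] at h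
  rw [← Real.norm_eq_abs, ← Complex.norm_real]
  push_cast
  exact h

-- In terms of `M = ρ y²` and `t = ρ y ξ ≥ M`, this is `M⁻ᵏ t²ᵏ / k! ≤ M⁻ⁿ tⁿ⁺ᵏ`.
lemma pow_div_factorial_le_inv_pow_mul_pow {ρ y ξ : ℝ} (hρ : 0 < ρ) (hy : 0 < y) (hyξ : y ≤ ξ)
    {k n : ℕ} (hkn : k ≤ n) :
    (ρ * ξ ^ 2) ^ k / (k.factorial : ℝ) ≤ ((ρ * y ^ 2) ^ n)⁻¹ * (ρ * y * ξ) ^ (n + k) := by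
  have hξ : 0 < ξ := hy.trans_le hyξ
  have hfact : (1 : ℝ) ≤ k.factorial := by exact_mod_cast k.factorial_pos
  obtain ⟨j, rfl⟩ := Nat.exists_eq_add_of_le hkn
  refine (div_le_self (by positivity) hfact).trans ?_
  rw [le_inv_mul_iff₀ (by positivity)]
  calc (ρ * y ^ 2) ^ (k + j) * (ρ * ξ ^ 2) ^ k
      = ρ ^ (2 * k + j) * y ^ (2 * k + j) * ξ ^ (2 * k) * y ^ j := by ring
    _ ≤ ρ ^ (2 * k + j) * y ^ (2 * k + j) * ξ ^ (2 * k) * ξ ^ j := by gcongr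
    _ = (ρ * y * ξ) ^ (k + j + k) := by ring

-- For `ξ ≤ y` this is Taylor's bound together with `ρ ξ² ≤ ρ y ξ`; for `y < ξ` the exponential is
-- absent and each term of the sum is bounded separately.
lemma abs_indicator_exp_sub_sum_le {ρ y ξ : ℝ} (hρ : 0 < ρ) (hy : 0 < y) (hξ : 0 < ξ) (n : ℕ) :
    |(Iic y).indicator (fun ξ => Real.exp (ρ * ξ ^ 2)) ξ -
        ∑ k ∈ Finset.range n, (ρ * ξ ^ 2) ^ k / (k.factorial : ℝ)| ≤
      ((ρ * y ^ 2) ^ n)⁻¹ * (∑ k ∈ Finset.range (n + 1), (ρ * y * ξ) ^ (n + k)) *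
        Real.exp (ρ * y * ξ) := by
  rcases le_or_gt ξ y with hξy | hyξ
  · rw [indicator_of_mem (mem_Iic.2 hξy)]
    have hexp : ρ * ξ ^ 2 ≤ ρ * y * ξ := by
      rw [sq, mul_assoc]
      gcongr
    calc _ ≤ (ρ * ξ ^ 2) ^ n * Real.exp (ρ * ξ ^ 2) := abs_exp_sub_sum_le (by positivity) n
      _ = ((ρ * y ^ 2) ^ n)⁻¹ * (ρ * y * ξ) ^ (n + n) * Real.exp (ρ * ξ ^ 2) := by
          rw [← inv_pow, ← two_mul, pow_mul, ← mul_pow]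
          congr 2
          field_simp
      _ ≤ _ := by
          gcongr
          exact Finset.single_le_sum (f := fun k => (ρ * y * ξ) ^ (n + k))
            (fun k _ => by positivity) (Finset.self_mem_range_succ n)
  · rw [indicator_of_notMem (notMem_Iic.2 hyξ), zero_sub, abs_neg, abs_of_nonneg (by positivity)]
    calc _ ≤ ((ρ * y ^ 2) ^ n)⁻¹ * ∑ k ∈ Finset.range n, (ρ * y * ξ) ^ (n + k) := by
          rw [Finset.mul_sum]
          exact Finset.sum_le_sum fun k hk =>
            pow_div_factorial_le_inv_pow_mul_pow hρ hy hyξ.le (Finset.mem_range.1 hk).le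
      _ ≤ ((ρ * y ^ 2) ^ n)⁻¹ * ∑ k ∈ Finset.range (n + 1), (ρ * y * ξ) ^ (n + k) := by
          gcongr
          exact n.le_succ
      _ ≤ _ := le_mul_of_one_le_right (by positivity) (Real.one_le_exp (by positivity))

lemma coeffIntegrand_zero_le {ξ : ℝ} (x : ℝ) (hξ : 0 < ξ) :
    coeffIntegrand 0 x ξ ≤ Real.exp (-x * ξ) / ξ := by
  have hle : ξ ≤ √(1 + ξ ^ 2) := Real.le_sqrt_of_sq_le (by linarith)
  rw [coeffIntegrand, mul_zero, pow_zero, one_mul]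
  gcongr

lemma integral_pow_mul_exp_neg_mul (n : ℕ) {c : ℝ} (hc : 0 < c) :
    ∫ ξ in Ioi (0 : ℝ), ξ ^ n * Real.exp (-c * ξ) = n.factorial / c ^ (n + 1) := by
  have h := Real.integral_rpow_mul_exp_neg_mul_Ioi (a := n + 1) (r := c) (by positivity) hc
  rw [Real.Gamma_nat_eq_factorial, ← Nat.cast_succ, Real.rpow_natCast] at h
  simp only [Nat.cast_succ, add_sub_cancel_right, Real.rpow_natCast] at h
  simp_rw [neg_mul]
  rw [h, one_div, inv_pow, div_eq_inv_mul]

/-- The constant `K_n` in the bound `K_n M⁻ⁿ` for the error of the asymptotic series truncated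
after `n ≥ 1` terms: the integral of `(2/π) (∑_{k ≤ n} tⁿ⁺ᵏ) e⁻ᵗ / t` over `t > 0`. -/
def remainderConst (n : ℕ) : ℝ :=
  2 / Real.pi * ∑ k ∈ Finset.range (n + 1), ((n + k - 1).factorial : ℝ)

lemma abs_remainder_integrand_le {x ρ ξ : ℝ} (hx : 0 < x) (hρ : 0 < ρ) (hξ : 0 < ξ) {n : ℕ}
    (hn : 1 ≤ n) :
    |(Iic (x / (2 * ρ))).indicator (fun ξ => Real.exp (ρ * ξ ^ 2)) ξ * coeffIntegrand 0 x ξ -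
        (∑ k ∈ Finset.range n, (ρ * ξ ^ 2) ^ k / (k.factorial : ℝ)) * coeffIntegrand 0 x ξ| ≤
      (bigM x ρ ^ n)⁻¹ * ∑ k ∈ Finset.range (n + 1),
        (x / 2) ^ (n + k) * (ξ ^ (n + k - 1) * Real.exp (-(x / 2) * ξ)) := by
  have hw : 0 ≤ coeffIntegrand 0 x ξ := by
    rw [coeffIntegrand]
    positivity
  have hy : ρ * (x / (2 * ρ)) = x / 2 := by field_simp
  have hexp : Real.exp (x / 2 * ξ) * Real.exp (-x * ξ) = Real.exp (-(x / 2) * ξ) := by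
    rw [← Real.exp_add]
    ring_nf
  have hind := abs_indicator_exp_sub_sum_le hρ (by positivity : 0 < x / (2 * ρ)) hξ n
  rw [hy, ← bigM_eq_mul_sq hρ] at hind
  have hM : 0 ≤ bigM x ρ := by
    rw [bigM]
    positivity
  rw [← sub_mul, abs_mul, abs_of_nonneg hw]
  calc _ ≤ (bigM x ρ ^ n)⁻¹ * (∑ k ∈ Finset.range (n + 1), (x / 2 * ξ) ^ (n + k)) *
        Real.exp (x / 2 * ξ) * (Real.exp (-x * ξ) / ξ) :=
      mul_le_mul hind (coeffIntegrand_zero_le x hξ) hw (by positivity)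
    _ = (bigM x ρ ^ n)⁻¹ * ∑ k ∈ Finset.range (n + 1),
          (x / 2 * ξ) ^ (n + k) * (Real.exp (-(x / 2) * ξ) / ξ) := by
        rw [← hexp, ← Finset.sum_mul]
        ring
    _ = _ := by
        congr 1
        refine Finset.sum_congr rfl fun k _ => ?_
        rw [mul_pow, ← mul_pow_sub_one (by omega : n + k ≠ 0) ξ]
        field_simp

lemma abs_integral_exp_sinh_sub_asympSum_le {x ρ : ℝ} (hx : 0 < x) (hρ : 0 < ρ) {n : ℕ}
    (hn : 1 ≤ n) :
    |2 / Real.pi * (∫ t in (0 : ℝ)..(Real.arsinh (x / (2 * ρ))),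
        Real.exp (ρ * Real.sinh t ^ 2 - x * Real.sinh t)) - asympSum x ρ n| ≤
      remainderConst n * (bigM x ρ ^ n)⁻¹ := by
  have hx₂ : 0 < x / 2 := by positivity
  have hi (k : ℕ) : IntegrableOn (fun ξ : ℝ =>
      (x / 2) ^ (n + k) * (ξ ^ (n + k - 1) * Real.exp (-(x / 2) * ξ))) (Ioi 0) :=
    (integrableOn_pow_mul_exp_neg_mul _ hx₂).const_mul _
  have hval (k : ℕ) : ∫ ξ in Ioi (0 : ℝ),
      (x / 2) ^ (n + k) * (ξ ^ (n + k - 1) * Real.exp (-(x / 2) * ξ)) =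
        (n + k - 1).factorial := by
    rw [integral_const_mul, integral_pow_mul_exp_neg_mul _ hx₂,
      Nat.sub_add_cancel (by omega : 1 ≤ n + k), mul_div_cancel₀ _ (by positivity)]
  rw [asympSum_eq_integral hx, integral_exp_sinh_eq_integral_indicator x ρ (by positivity),
    ← mul_sub, ← integral_sub (integrableOn_indicator_mul_coeffIntegrand x ρ _)
      (integrableOn_sum_mul_coeffIntegrand ρ hx n), abs_mul, abs_of_pos (by positivity),
    remainderConst, mul_assoc]
  gcongr
  rw [← Real.norm_eq_abs]
  refine (norm_integral_le_of_norm_le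
    ((integrable_finsetSum (Finset.range (n + 1)) fun k _ => hi k).const_mul (bigM x ρ ^ n)⁻¹)
    (ae_restrict_of_forall_mem measurableSet_Ioi fun ξ hξ =>
      abs_remainder_integrand_le hx hρ hξ hn)).trans_eq ?_
  rw [integral_const_mul, integral_finsetSum _ fun k _ => hi k, mul_comm]
  simp_rw [hval]

lemma pi_mul_tsum_struveTerm {x : ℝ} (hx : 0 < x) (ρ : ℝ) :
    Real.pi * ∑' r, struveTerm x ρ r = 2 * (Real.exp ρ * ∫ b in (0 : ℝ)..(Real.pi / 2),
      Real.exp (-ρ * Real.cos b ^ 2) * Real.sin (x * Real.cos b)) := by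
  rw [(hasSum_struveTerm hx ρ).tsum_eq, ← mul_assoc, mul_div_cancel₀ _ Real.pi_ne_zero,
    ← intervalIntegral.integral_const_mul (Real.exp ρ)]
  congr 1
  refine intervalIntegral.integral_congr fun b _ => ?_
  rw [← mul_assoc, ← Real.exp_add, Real.sin_sq]
  ring_nf

lemma F_zero_eq {x ρ : ℝ} (hx : 0 < x) (hρ : 0 < ρ) (a : ℝ) : F x ρ 0 =
    ((-Real.pi * Real.exp (-ρ / 2) * ∑' r, struveTerm x ρ r + 2 * Real.exp (ρ / 2) *
      ((∫ t in (0 : ℝ)..a, Real.exp (ρ * Real.sinh t ^ 2 - x * Real.sinh t)) +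
        (∫ b in (0 : ℝ)..(Real.pi / 2), waveExp x ρ (a + b * Complex.I)).im +
        (∫ t in Ioi a, waveExp x ρ t).re) : ℝ) : ℂ) := by
  have hexp : Real.exp (ρ / 2) = Real.exp (-ρ / 2) * Real.exp ρ := by
    rw [← Real.exp_add]
    ring_nf
  rw [F_zero_eq_re_integral x hρ a, re_integral_waveExp, hexp]
  congr 1
  linear_combination Real.exp (-ρ / 2) * pi_mul_tsum_struveTerm hx ρ

lemma exists_F_zero_eq {x ρ : ℝ} (hx : 0 < x) (hρ : 0 < ρ) {n : ℕ} (hn : 1 ≤ n) :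
    ∃ E₁ E₂ E₃ : ℝ,
      |E₁| ≤ remainderConst n * (bigM x ρ ^ n)⁻¹ ∧
      |E₂| ≤ Real.pi * Real.exp (ρ / 2) * Real.exp (-bigM x ρ) ∧
      |E₃| ≤ Real.exp (ρ / 2) * ((bigM x ρ)⁻¹ * Real.exp (-bigM x ρ)) ∧
      F x ρ 0 = ((-Real.pi * Real.exp (-ρ / 2) * ∑' r : ℕ, struveTerm x ρ r
        + Real.pi * Real.exp (ρ / 2) * (asympSum x ρ n + E₁) + E₂ + E₃ : ℝ) : ℂ) := by
  have hscale {E b c : ℝ} (h : |E| ≤ b * c) :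
      |2 * Real.exp (ρ / 2) * E| ≤ 2 * b * Real.exp (ρ / 2) * c := by
    calc |2 * Real.exp (ρ / 2) * E| = 2 * Real.exp (ρ / 2) * |E| := by
          rw [abs_mul, abs_of_pos (by positivity)]
      _ ≤ 2 * Real.exp (ρ / 2) * (b * c) := by gcongr
      _ = 2 * b * Real.exp (ρ / 2) * c := by ring
  have hcancel (V : ℝ) :
      Real.pi * Real.exp (ρ / 2) * (2 / Real.pi * V) = 2 * Real.exp (ρ / 2) * V := by
    field_simp
  refine ⟨_, _, _, abs_integral_exp_sinh_sub_asympSum_le hx hρ hn,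
    (hscale (abs_im_integral_waveExp_saddle_le x hρ)).trans_eq ?_,
    (hscale (abs_re_integral_Ioi_waveExp_saddle_le hx hρ)).trans_eq ?_, ?_⟩
  · rw [mul_div_cancel₀ _ two_ne_zero]
  · rw [mul_one_div_cancel two_ne_zero, one_mul]
  · rw [F_zero_eq hx hρ (Real.arsinh (x / (2 * ρ))), add_sub_cancel, hcancel]
    congr 1
    ring

end KelvinWave

end

theorem theorem1_general :
    (∀ x : ℝ, 0 < x → ∀ m : ℕ,
      MeasureTheory.IntegrableOn (KelvinWave.coeffIntegrand m x) (Set.Ioi 0) ∧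
      KelvinWave.coeffC m x =
        2 ^ m * KelvinWave.poch (1 / 2) m * KelvinWave.scaledK m x -
          ∑ r ∈ Finset.range m,
            (m.choose r : ℝ) * x ^ (2 * (m - r)) * KelvinWave.coeffC r x) ∧
    (∃ K : ℕ → ℝ, ∀ R : ℝ, ∃ A B : ℝ, ∀ x ρ : ℝ, 0 < x → 0 < ρ → ρ ≤ R →
      MeasureTheory.Integrable (KelvinWave.integrand x ρ 0) ∧
      Summable (KelvinWave.struveTerm x ρ) ∧
      ∀ n : ℕ, 1 ≤ n →
        ∃ E₁ E₂ E₃ : ℝ,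
          |E₁| ≤ K n * (KelvinWave.bigM x ρ ^ n)⁻¹ ∧
          |E₂| ≤ A * Real.exp (-KelvinWave.bigM x ρ) ∧
          |E₃| ≤ B * ((KelvinWave.bigM x ρ)⁻¹ * Real.exp (-KelvinWave.bigM x ρ)) ∧
          KelvinWave.F x ρ 0 =
            ((-Real.pi * Real.exp (-ρ / 2) * ∑' r : ℕ, KelvinWave.struveTerm x ρ r
              + Real.pi * Real.exp (ρ / 2) * (KelvinWave.asympSum x ρ n + E₁)
              + E₂ + E₃ : ℝ) : ℂ)) := by
  refine ⟨fun x hx m => ⟨KelvinWave.integrableOn_coeffIntegrand m hx,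
    KelvinWave.coeffC_recurrence m hx⟩, KelvinWave.remainderConst, fun R =>
    ⟨Real.pi * Real.exp (R / 2), Real.exp (R / 2), fun x ρ hx hρ hρR => ?_⟩⟩
  refine ⟨KelvinWave.integrable_integrand_zero x hρ, (KelvinWave.hasSum_struveTerm hx ρ).summable,
    fun n hn => ?_⟩
  obtain ⟨E₁, E₂, E₃, h₁, h₂, h₃, hF⟩ := KelvinWave.exists_F_zero_eq hx hρ hn
  have hM : 0 < KelvinWave.bigM x ρ := by
    rw [KelvinWave.bigM]
    positivity
  exact ⟨E₁, E₂, E₃, h₁, h₂.trans (by gcongr), h₃.trans (by gcongr), hF⟩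

theorem theorem1 :
    (∀ x : ℝ, 0 < x → ∀ m : ℕ,
      MeasureTheory.IntegrableOn (KelvinWave.coeffIntegrand m x) (Set.Ioi 0) ∧
      KelvinWave.coeffC m x =
        2 ^ m * KelvinWave.poch (1 / 2) m * KelvinWave.scaledK m x -
          ∑ r ∈ Finset.range m,
            (m.choose r : ℝ) * x ^ (2 * (m - r)) * KelvinWave.coeffC r x) ∧
    (∀ X R : ℝ, 0 < X → 0 < R →
      ∃ (A B : ℝ) (K : ℕ → ℝ), ∀ x ρ : ℝ, 0 < x → x < X → 0 < ρ → ρ < R →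
        MeasureTheory.Integrable (KelvinWave.integrand x ρ 0) ∧
        Summable (KelvinWave.struveTerm x ρ) ∧
        ∀ n : ℕ, 1 ≤ n → (n : ℝ) < KelvinWave.bigM x ρ →
          ∃ E₁ E₂ E₃ : ℝ,
            |E₁| ≤ K n * (KelvinWave.bigM x ρ ^ n)⁻¹ ∧
            |E₂| ≤ A * Real.exp (-KelvinWave.bigM x ρ) ∧
            |E₃| ≤ B * ((KelvinWave.bigM x ρ)⁻¹ * Real.exp (-KelvinWave.bigM x ρ)) ∧
            KelvinWave.F x ρ 0 =
              ((-Real.pi * Real.exp (-ρ / 2) * ∑' r : ℕ, KelvinWave.struveTerm x ρ r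
                + Real.pi * Real.exp (ρ / 2) * (KelvinWave.asympSum x ρ n + E₁)
                + E₂ + E₃ : ℝ) : ℂ)) := by
  obtain ⟨h, K, hK⟩ := theorem1_general
  refine ⟨h, fun X R _ _ => ?_⟩
  obtain ⟨A, B, hAB⟩ := hK R
  refine ⟨A, B, K, fun x ρ hx _ hρ hρR => ?_⟩
  obtain ⟨hint, hsum, hE⟩ := hAB x ρ hx hρ hρR.le
  exact ⟨hint, hsum, fun n hn _ => hE n hn⟩
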